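/- Let $r\ge 0$ and let $Q:\mathbb Z^{2r}\to\mathbb Z$ be a positive-definite integral quadratic form, with bilinear form $\langle x,y\rangle=Q(x+y)-Q(x)-Q(y)$, extended $\mathbb C$-bilinearly to $\mathbb C^{2r}$, and Gram matrix $A$ in the standard basis (so $\langle x,y\rangle=x^{t}Ay$ and $Q(x)=\tfrac12 x^{t}Ax$). Let $N$ be the level of $Q$, i.e. the least positive integer such that $NA^{-1}$ has integral entries and even diagonal entries. There is exactly one Dirichlet character $\varepsilon$ modulo $N$ with $\varepsilon(n)=\left(\frac{(-1)^r\det A}{n}\right)$ (Jacobi symbol) for all odd integers $n>0$. For $v\in\mathbb C^{2r}$, an integer $k\ge 0$, $\tau$ in the upper half-plane $\mathfrak h$ and $X\in\mathbb C$, the series $$\theta(Q,v,k,\tau)=\sum_{m\in\mathbb Z^{2r}}\langle v,m\rangle^{k}e^{2\pi i Q(m)\tau},\qquad \Theta(Q,v,\tau,X)=\sum_{n\ge 0}\frac{2^n\,\theta(Q,v,2n,\tau)}{(2n)!}(2\pi i X)^n$$ converge absolutely, and for every $v\in\mathbb C^{2r}$, every $\gamma=\begin{pmatrix}a&b\\c&d\end{pmatrix}\in\Gamma_0(N)$,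 every $\tau\in\mathfrak h$ and every $X\in\mathbb C$, $$\Theta\!\left(Q,v,\gamma\tau,\frac{X}{(c\tau+d)^2}\right)=\varepsilon(d)\,(c\tau+d)^{r}\exp\!\left(\frac{c\,\langle v,v\rangle X}{c\tau+d}\right)\Theta(Q,v,\tau,X).$$ -/

import Mathlib

open scoped MatrixGroups

namespace QuadTheta

/-- The Gram matrix `A` of the bilinear form `⟨x, y⟩ = Q (x + y) - Q x - Q y` of the integral
quadratic form `Q` on `ℤ ^ f`, in the standard basis. It is symmetric, its diagonal entries
`2 * Q (e i)` are even, and `Q x = x' A x / 2`. -/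
def gram {f : ℕ} (Q : QuadraticForm ℤ (Fin f → ℤ)) : Matrix (Fin f) (Fin f) ℤ :=
  Matrix.of fun i j => QuadraticMap.polar Q (Pi.single i 1) (Pi.single j 1)

/-- The `ℂ`-bilinear extension `⟨x, y⟩ = x' A y` of the bilinear form of `Q` to `ℂ ^ f`. -/
def pairing {f : ℕ} (Q : QuadraticForm ℤ (Fin f → ℤ)) (x y : Fin f → ℂ) : ℂ :=
  ∑ i, ∑ j, x i * (gram Q i j : ℂ) * y j

/-- The level of `Q`: the least `N ≥ 1` such that `B = N A⁻¹` is an even matrix, that is,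
has integral entries and even diagonal entries. -/
noncomputable def level {f : ℕ} (Q : QuadraticForm ℤ (Fin f → ℤ)) : ℕ :=
  sInf {N : ℕ | 0 < N ∧ ∃ B : Matrix (Fin f) (Fin f) ℤ,
    gram Q * B = (N : ℤ) • (1 : Matrix (Fin f) (Fin f) ℤ) ∧ ∀ i, Even (B i i)}

/-- `ε` is the Dirichlet character modulo the level of `Q` given by the Jacobi symbol
`((-1) ^ r * det A / n)` at every positive integer `n` where that symbol is defined,
that is, at every odd `n`. -/
def IsCharacterOf {r : ℕ} (Q : QuadraticForm ℤ (Fin (2 * r) → ℤ))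
    (ε : DirichletCharacter ℂ (level Q)) : Prop :=
  ∀ n : ℕ, Odd n → ε (n : ZMod (level Q)) = (jacobiSym ((-1) ^ r * (gram Q).det) n : ℂ)

/-- The term `⟨v, m⟩ ^ k * exp (2 π i Q(m) τ)` of the theta series. -/
noncomputable def thetaTerm {f : ℕ} (Q : QuadraticForm ℤ (Fin f → ℤ)) (v : Fin f → ℂ) (k : ℕ)
    (τ : UpperHalfPlane) (m : Fin f → ℤ) : ℂ :=
  pairing Q v (fun i => (m i : ℂ)) ^ k *
    Complex.exp (2 * Real.pi * Complex.I * (Q m : ℂ) * (τ : ℂ))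

/-- The theta series `θ(Q, v, k, τ)`. -/
noncomputable def theta {f : ℕ} (Q : QuadraticForm ℤ (Fin f → ℤ)) (v : Fin f → ℂ) (k : ℕ)
    (τ : UpperHalfPlane) : ℂ :=
  ∑' m : Fin f → ℤ, thetaTerm Q v k τ m

/-- The term of index `n` of the generating series `Θ(Q, v, τ, X)`. -/
noncomputable def genTerm {f : ℕ} (Q : QuadraticForm ℤ (Fin f → ℤ)) (v : Fin f → ℂ)
    (τ : UpperHalfPlane) (X : ℂ) (n : ℕ) : ℂ :=
  2 ^ n * theta Q v (2 * n) τ / ((2 * n).factorial : ℂ) * (2 * Real.pi * Complex.I * X) ^ n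

/-- The generating series `Θ(Q, v, τ, X)`, a function on the upper half-plane times `ℂ`. -/
noncomputable def genTheta {f : ℕ} (Q : QuadraticForm ℤ (Fin f → ℤ)) (v : Fin f → ℂ)
    (τ : UpperHalfPlane) (X : ℂ) : ℂ :=
  ∑' n : ℕ, genTerm Q v τ X n

end QuadTheta

/-!
The generating series is a Jacobi theta series in disguise. Choose `w` with `w² = 4πiX`; then
`Θ(Q, v, τ, X) = ∑ₘ cosh (w ⟨v, m⟩) e(Q(m) τ)`, where `e(x) = exp (2πix)`, and by the symmetry
`m ↦ -m` this is `ϑ(τ, z) = ∑ₘ e(Q(m) τ + ⟨z, m⟩)` at `z = w v / (2πi)` (`genTheta_eq_jtheta`).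
Replacing `(τ, X)` by `(γτ, X / (cτ + d)²)` replaces `z` by `z / (cτ + d)`, so the theorem says that
`ϑ` transforms like a Jacobi form of weight `r` with character `ε`; the exponential factor is
`e(c Q(z) / (cτ + d))`.

For `c > 0` one has `γτ = a/c - 1/(c(cτ + d))`. Splitting `ϑ` into residue classes modulo `c` and
applying Poisson summation for Gaussians in each class (`hasSum_gauss`) gives a sum over the dual
lattice, weighted by the exponential sums `∑ e((a Q(g) + ⟨μ, g⟩) / c)` over `g` modulo `c`
(`jtheta_inversion`). If the level divides `c`, translating `g` by suitable vectors shows that these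
sums vanish for dual vectors `μ` outside the lattice (`exists_mulVec_eq_of_expSum_ne_zero`), and
that for `μ` in the lattice they equal the sum for `μ = 0` up to the phase `e(-d Q(μ) / c)`
(`expSum_mulVec`). Hence `ϑ` transforms under every `γ ∈ Γ₀(N)` up to a constant `C(γ)`
(`exists_transforms`).

The constant is multiplicative in `γ`. Letting `τ → 0` along the imaginary axis gives
`C(γ) = d⁻ʳ ∑ e(b Q(g) / d)`, `g` modulo `d`, when `d > 0` (`Transforms.eq_expSum`). It follows that
`C(γ) = 1` if `d = 1`, and, diagonalizing `Q` modulo an odd prime, that `C(γ)` is the Jacobi symbol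
`((-1)ʳ det A / p)` if `d = p` is such a prime. By Dirichlet's theorem on primes in arithmetic
progressions one can always reach a prime `d` without changing `C(γ)`, so that `C(γ)` only depends
on `d` modulo `N` (`Transforms.eq_of_eq`). Thus `C` is a Dirichlet character modulo `N`, and it
agrees with the Jacobi symbol at odd primes, hence at all odd numbers (`exists_character`). In
particular the existence of `ε` is a consequence of the transformation law.
-/

/-! ### Poisson summation on a lattice -/

namespace QuadTheta
open MeasureTheory

variable {ι : Type*} [Fintype ι]

lemma summable_pi_prod {β : Type*} {f : ι → β → ℝ} (h0 : ∀ i b, 0 ≤ f i b)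
    (hf : ∀ i, Summable (f i)) : Summable fun l : ι → β => ∏ i, f i (l i) := by
  classical
  refine summable_of_sum_le (c := ∏ i, ∑' b, f i b)
    (fun l => Finset.prod_nonneg fun i _ => h0 i _) fun u => ?_
  calc ∑ l ∈ u, ∏ i, f i (l i)
      ≤ ∑ l ∈ Fintype.piFinset fun i => u.image fun l => l i, ∏ i, f i (l i) := by
        refine Finset.sum_le_sum_of_subset_of_nonneg (fun l hl => ?_)
          fun l _ _ => Finset.prod_nonneg fun i _ => h0 i _
        exact Fintype.mem_piFinset.2 fun i => Finset.mem_image_of_mem _ hl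
    _ = ∏ i, ∑ b ∈ u.image fun l => l i, f i b := (Finset.prod_univ_sum _ _).symm
    _ ≤ ∏ i, ∑' b, f i b :=
        Finset.prod_le_prod (fun i _ => Finset.sum_nonneg fun b _ => h0 i b)
          fun i _ => (hf i).sum_le_tsum _ fun b _ => h0 i b

lemma summable_exp_neg_norm :
    Summable fun l : ι → ℤ => Real.exp (-‖fun i => (l i : ℝ)‖) := by
  set a : ℝ := ((Fintype.card ι : ℝ) + 1)⁻¹ with ha
  have ha0 : 0 < a := by positivity
  have h1 : Summable fun n : ℤ => Real.exp (-(a * |(n : ℝ)|)) := by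
    have h2 : Summable fun n : ℕ => Real.exp (-(a * n)) := by
      simpa [mul_comm] using Real.summable_exp_nat_mul_iff.2 (neg_lt_zero.2 ha0)
    refine Summable.of_nat_of_neg ?_ ?_ <;> simpa using h2
  refine Summable.of_nonneg_of_le (fun l => (Real.exp_pos _).le) (fun l => ?_)
    (summable_pi_prod (fun _ n => (Real.exp_pos (-(a * |(n : ℝ)|))).le) fun _ : ι => h1)
  rw [← Real.exp_sum, Real.exp_le_exp, Finset.sum_neg_distrib, neg_le_neg_iff, ← Finset.mul_sum,
    ha, inv_mul_le_iff₀ (by positivity)]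
  set y : ι → ℝ := fun i => (l i : ℝ)
  calc ∑ i, |y i| ≤ ∑ _i : ι, ‖y‖ := Finset.sum_le_sum fun i _ => norm_le_pi_norm y i
    _ = Fintype.card ι * ‖y‖ := by simp
    _ ≤ _ := by nlinarith [norm_nonneg y]

/-- The cube `∏ (lᵢ, lᵢ + 1]`. -/
def unitCube (l : ι → ℝ) : Set (ι → ℝ) := {x | ∀ i, x i ∈ Set.Ioc (l i) (l i + 1)}

lemma measurableSet_unitCube (l : ι → ℝ) : MeasurableSet (unitCube l) :=
  MeasurableSet.univ_pi' fun _ => measurableSet_Ioc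

lemma volume_unitCube (l : ι → ℝ) : volume (unitCube l) = 1 := by
  have : unitCube l = Set.univ.pi fun i => Set.Ioc (l i) (l i + 1) := by
    ext; simp [unitCube]
  rw [this, volume_pi_pi]; simp

/-- The integral over `ℝ^ι` is the sum of the integrals over the translates of the unit cube. -/
lemma hasSum_integral_unitCube {G : (ι → ℝ) → ℂ} (hG : Integrable G) :
    HasSum (fun l : ι → ℤ => ∫ x in unitCube (0 : ι → ℝ), G (x + fun i => (l i : ℝ)))
      (∫ x, G x) := by
  have hdis : Pairwise (Function.onFun Disjoint fun l : ι → ℤ => unitCube fun i => (l i : ℝ)) := by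
    intro l l' hne
    refine Set.disjoint_left.2 fun x hx hx' => hne (funext fun i => ?_)
    have h1 := hx i; have h2 := hx' i
    simp only [Set.mem_Ioc] at h1 h2
    have h3 : (l i : ℝ) < l' i + 1 := h1.1.trans_le h2.2
    have h4 : (l' i : ℝ) < l i + 1 := h2.1.trans_le h1.2
    norm_cast at h3 h4
    omega
  have hun : ⋃ l : ι → ℤ, unitCube (fun i => (l i : ℝ)) = Set.univ := by
    refine Set.eq_univ_of_forall fun x => Set.mem_iUnion.2 ⟨fun i => ⌈x i⌉ - 1, fun i => ?_⟩
    simp only [Set.mem_Ioc]; push_cast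
    exact ⟨by linarith [Int.ceil_lt_add_one (x i)], by linarith [Int.le_ceil (x i)]⟩
  have := hasSum_integral_iUnion (μ := volume) (f := G)
    (fun l : ι → ℤ => measurableSet_unitCube fun i => (l i : ℝ)) hdis hG.integrableOn
  rw [hun, Measure.restrict_univ] at this
  refine this.congr_fun fun l => ?_
  rw [← integral_indicator (measurableSet_unitCube _), ← integral_indicator (measurableSet_unitCube _),
    ← integral_add_right_eq_self ((unitCube fun i => (l i : ℝ)).indicator G) fun i => (l i : ℝ)]
  congr 1; ext x
  simp only [Set.indicator]
  congr 1
  simp only [unitCube, Set.mem_ofPred_eq, Set.mem_Ioc, Pi.add_apply, eq_iff_iff, Pi.zero_apply]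
  exact forall_congr' fun i => by constructor <;> rintro ⟨_, _⟩ <;> constructor <;> linarith

/-- Poisson summation on `ℤ^ι`, for a continuous function of exponential decay. -/
theorem poisson_summation {F : (ι → ℝ) → ℂ} (hc : Continuous F) (hi : Integrable F)
    {C : ℝ} (hC : ∀ y, ‖F y‖ ≤ C * Real.exp (-‖y‖))
    (hs : Summable fun n : ι → ℤ =>
      ∫ y, Complex.exp (-(2 * Real.pi * Complex.I * ∑ i, (n i : ℂ) * (y i : ℂ))) * F y)
    (x : ι → ℝ) :
    HasSum (fun n : ι → ℤ =>
      (∫ y, Complex.exp (-(2 * Real.pi * Complex.I * ∑ i, (n i : ℂ) * (y i : ℂ))) * F y) *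
        Complex.exp (2 * Real.pi * Complex.I * ∑ i, (n i : ℂ) * (x i : ℂ)))
      (∑' l : ι → ℤ, F (x + fun i => (l i : ℝ))) := by
  have hC0 : 0 ≤ C := by
    have := (norm_nonneg _).trans (hC 0)
    simpa using this
  -- on a ball of radius `R`, the translates of `F` are dominated by a fixed summable family
  have hbd : ∀ R : ℝ, ∀ x : ι → ℝ, ‖x‖ ≤ R → ∀ l : ι → ℤ,
      ‖F (x + fun i => (l i : ℝ))‖ ≤ C * Real.exp R * Real.exp (-‖fun i => (l i : ℝ)‖) := by
    intro R x hx l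
    refine (hC _).trans ?_
    rw [mul_assoc, ← Real.exp_add]
    gcongr
    have := norm_sub_norm_le (fun i => (l i : ℝ)) (-x)
    rw [norm_neg, sub_neg_eq_add, add_comm _ x] at this
    linarith
  have hsum : ∀ R : ℝ, Summable fun l : ι → ℤ =>
      C * Real.exp R * Real.exp (-‖fun i => (l i : ℝ)‖) :=
    fun R => summable_exp_neg_norm.mul_left _
  set P : (ι → ℝ) → ℂ := fun x => ∑' l : ι → ℤ, F (x + fun i => (l i : ℝ)) with hP
  have hPc : Continuous P := by
    refine continuous_iff_continuousAt.2 fun x => ?_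
    have : ContinuousOn P (Metric.ball 0 (‖x‖ + 1)) := by
      refine continuousOn_tsum (fun l => ?_) (hsum (‖x‖ + 1)) fun l y hy => ?_
      · exact (hc.comp (continuous_id.add continuous_const)).continuousOn
      · exact hbd _ y (by simpa using (mem_ball_zero_iff.1 hy).le) l
    exact this.continuousAt (Metric.isOpen_ball.mem_nhds (by simp))
  have hPper : ∀ x (k : ι → ℤ), P (x + fun i => (k i : ℝ)) = P x := by
    intro x k
    simp only [hP]
    rw [← (Equiv.addLeft k).tsum_eq fun l : ι → ℤ => F (x + fun i => (l i : ℝ))]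
    refine tsum_congr fun l => ?_
    congr 1; ext i; simp [add_assoc]
  -- the periodization descends to a continuous function on the torus, whose Fourier series
  -- converges to it
  set q : (ι → ℝ) → UnitAddTorus ι := fun x i => (x i : UnitAddCircle) with hq
  have hqo : IsOpenQuotientMap q := IsOpenQuotientMap.piMap fun _ =>
    QuotientAddGroup.isOpenQuotientMap_mk
  set f : UnitAddTorus ι → ℂ := fun t => P (Function.surjInv hqo.surjective t) with hf
  have hfq : ∀ x, f (q x) = P x := by
    intro x
    have h1 : q (Function.surjInv hqo.surjective (q x)) = q x := Function.surjInv_eq _ _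
    have h2 : ∀ i, ∃ k : ℤ, x i + k = Function.surjInv hqo.surjective (q x) i := by
      intro i
      have h3 := congrFun h1 i
      simp only [hq] at h3
      rw [← sub_eq_zero, ← AddCircle.coe_sub, AddCircle.coe_eq_zero_iff] at h3
      obtain ⟨k, hk⟩ := h3
      exact ⟨k, by rw [zsmul_one] at hk; linarith⟩
    choose k hk using h2
    simp only [hf]
    rw [← hPper x k]; congr 1; ext i; exact (hk i).symm
  have hfc : Continuous f := by
    refine hqo.isQuotientMap.continuous_iff.2 ?_
    have : f ∘ q = P := funext hfq
    rwa [this]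
  have hmq : ∀ n x, UnitAddTorus.mFourier n (q x) =
      Complex.exp (2 * Real.pi * Complex.I * ∑ i, (n i : ℂ) * (x i : ℂ)) := by
    intro n x
    simp only [UnitAddTorus.mFourier, ContinuousMap.coe_mk, hq, fourier_coe_apply,
      ← Complex.exp_sum, Finset.mul_sum]
    congr 1
    refine Finset.sum_congr rfl fun i _ => ?_
    push_cast; ring
  set E : (ι → ℤ) → (ι → ℝ) → ℂ := fun n y =>
    Complex.exp (-(2 * Real.pi * Complex.I * ∑ i, (n i : ℂ) * (y i : ℂ))) with hE
  have hEn : ∀ n y, ‖E n y‖ = 1 := by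
    intro n y
    have : -(2 * Real.pi * Complex.I * ∑ i, (n i : ℂ) * (y i : ℂ)) =
      ((-(2 * Real.pi * ∑ i, (n i : ℝ) * y i) : ℝ) : ℂ) * Complex.I := by push_cast; ring
    simp only [hE]
    rw [this, Complex.norm_exp_ofReal_mul_I]
  have hEc : ∀ n, Continuous (E n) := fun n => by simp only [hE]; fun_prop
  have hEper : ∀ n y (l : ι → ℤ), E n (y + fun i => (l i : ℝ)) = E n y := by
    intro n y l
    simp only [hE, Pi.add_apply]
    rw [Complex.exp_eq_exp_iff_exists_int]
    refine ⟨-∑ i, n i * l i, ?_⟩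
    push_cast
    simp only [mul_add, Finset.sum_add_distrib]
    ring
  have hcoef : ∀ n, UnitAddTorus.mFourierCoeff f n = ∫ y, E n y * F y := by
    intro n
    have hGi : Integrable fun y => E n y * F y :=
      hi.bdd_mul (hEc n).aestronglyMeasurable (Filter.Eventually.of_forall fun y => (hEn n y).le)
    rw [UnitAddTorus.mFourierCoeff_eq_integral f n 0]
    have h1 : HasSum (fun l : ι → ℤ => ∫ x in unitCube (0 : ι → ℝ),
        E n (x + fun i => (l i : ℝ)) * F (x + fun i => (l i : ℝ)))
        (∫ x in unitCube (0 : ι → ℝ), E n x * P x) := by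
      have : IsFiniteMeasure (volume.restrict (unitCube (0 : ι → ℝ))) :=
        ⟨by simp [volume_unitCube]⟩
      have hae : ∀ᵐ x ∂(volume.restrict (unitCube (0 : ι → ℝ))), ‖x‖ ≤ 1 := by
        refine (ae_restrict_iff' (measurableSet_unitCube _)).2 (Filter.Eventually.of_forall ?_)
        intro x hx
        refine (pi_norm_le_iff_of_nonneg zero_le_one).2 fun i => ?_
        have := hx i
        simp only [Pi.zero_apply, zero_add, Set.mem_Ioc] at this
        rw [Real.norm_eq_abs, abs_le]; constructor <;> linarith
      refine hasSum_integral_of_dominated_convergence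
        (fun l _ => C * Real.exp 1 * Real.exp (-‖fun i => (l i : ℝ)‖)) (fun l => ?_) (fun l => ?_)
        ?_ ?_ ?_
      · refine Continuous.aestronglyMeasurable ?_
        exact ((hEc n).mul hc).comp (continuous_id.add continuous_const)
      · filter_upwards [hae] with x hx
        rw [norm_mul, hEn, one_mul]
        exact hbd 1 x hx l
      · exact Filter.Eventually.of_forall fun _ => hsum 1
      · exact integrable_const _
      · filter_upwards [hae] with x hx
        simp only [hEper]
        exact ((hsum 1).of_norm_bounded (hbd 1 x hx)).hasSum.mul_left _
    have h2 := hasSum_integral_unitCube hGi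
    rw [← h1.unique h2]
    refine setIntegral_congr_fun (measurableSet_unitCube _) fun x _ => ?_
    simp only [smul_eq_mul]
    change UnitAddTorus.mFourier (-n) (q x) * f (q x) = _
    rw [hfq, hmq]
    simp [hE]
  have := UnitAddTorus.hasSum_mFourier_series_apply_of_summable (f := ⟨f, hfc⟩)
    (by convert hs with n; exact hcoef n) (q x)
  simp only [ContinuousMap.coe_mk, hfq, hcoef, hmq, smul_eq_mul] at this
  exact this

end QuadTheta

/-! ### Gaussians of positive definite matrices -/

namespace QuadTheta
open MeasureTheory Matrix
open scoped MatrixOrder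

variable {ι : Type*} [Fintype ι]

/-- The `ℂ`-bilinear form `xᵗ S y` on `ℂ^ι` of a real matrix `S`. -/
noncomputable def cbil (S : Matrix ι ι ℝ) (x y : ι → ℂ) : ℂ :=
  x ⬝ᵥ (S.map (algebraMap ℝ ℂ)) *ᵥ y

/-- The Gaussian `exp (-b yᵗ S y + c · y)` with complex parameters. -/
noncomputable def gauss (S : Matrix ι ι ℝ) (b : ℂ) (c : ι → ℂ) (y : ι → ℝ) : ℂ :=
  Complex.exp (-b * cbil S (fun i => (y i : ℂ)) (fun i => (y i : ℂ)) + ∑ i, c i * (y i : ℂ))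

lemma cbil_transpose_mul_self (B : Matrix ι ι ℝ) (y : ι → ℝ) :
    cbil (Bᵀ * B) (fun i => (y i : ℂ)) (fun i => (y i : ℂ)) =
      ∑ i, (((B *ᵥ y) i : ℝ) : ℂ) ^ 2 := by
  have h : ∀ i, (((B *ᵥ y) i : ℝ) : ℂ) = (B.map (algebraMap ℝ ℂ) *ᵥ fun i => (y i : ℂ)) i := by
    intro i; simp [mulVec, dotProduct]
  simp only [h, cbil]
  rw [Matrix.map_mul, ← mulVec_mulVec, dotProduct_mulVec, transpose_map, vecMul_transpose]
  simp [dotProduct, pow_two]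

lemma cbil_ofReal (S : Matrix ι ι ℝ) (x y : ι → ℝ) :
    cbil S (fun i => (x i : ℂ)) (fun i => (y i : ℂ)) = ((x ⬝ᵥ S *ᵥ y : ℝ) : ℂ) := by
  simp [cbil, dotProduct, mulVec]

lemma continuous_gauss (S : Matrix ι ι ℝ) (b : ℂ) (c : ι → ℂ) : Continuous (gauss S b c) := by
  unfold gauss cbil dotProduct mulVec dotProduct
  fun_prop

lemma cbil_add_left (S : Matrix ι ι ℝ) (x x' y : ι → ℂ) :
    cbil S (x + x') y = cbil S x y + cbil S x' y := by
  simp [cbil, add_dotProduct]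

lemma cbil_add_right (S : Matrix ι ι ℝ) (x y y' : ι → ℂ) :
    cbil S x (y + y') = cbil S x y + cbil S x y' := by
  simp [cbil, mulVec_add, dotProduct_add]

lemma cbil_smul_left (S : Matrix ι ι ℝ) (t : ℂ) (x y : ι → ℂ) :
    cbil S (t • x) y = t * cbil S x y := by
  simp [cbil]

lemma cbil_smul_right (S : Matrix ι ι ℝ) (t : ℂ) (x y : ι → ℂ) :
    cbil S x (t • y) = t * cbil S x y := by
  simp [cbil, mulVec_smul]

lemma cbil_comm {S : Matrix ι ι ℝ} (hS : Sᵀ = S) (x y : ι → ℂ) : cbil S x y = cbil S y x := by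
  rw [cbil, cbil, dotProduct_comm, ← vecMul_transpose, ← dotProduct_mulVec,
    ← transpose_map, hS]

lemma cbil_eq_sum (S : Matrix ι ι ℝ) (x y : ι → ℂ) :
    cbil S x y = ∑ i, (x ᵥ* S.map (algebraMap ℝ ℂ)) i * y i := by
  rw [cbil, dotProduct_mulVec]; rfl

lemma posDef_transpose_eq {κ : Type*} {S : Matrix κ κ ℝ} (hS : S.PosDef) : Sᵀ = S := by
  rw [← conjTranspose_eq_transpose_of_trivial]; exact hS.isHermitian

/-- A Gaussian, even times an increasing exponential, is dominated by any decreasing exponential. -/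
lemma exp_neg_sq_add_le {δ : ℝ} (hδ : 0 < δ) (K R t : ℝ) :
    Real.exp (-δ * t ^ 2 + K * t) ≤ Real.exp ((K + R) ^ 2 / (4 * δ)) * Real.exp (-(R * t)) := by
  rw [← Real.exp_add, Real.exp_le_exp]
  have h : (K + R) ^ 2 / (4 * δ) - (-δ * t ^ 2 + (K + R) * t) =
      (2 * δ * t - (K + R)) ^ 2 / (4 * δ) := by field_simp; ring
  have : 0 ≤ (2 * δ * t - (K + R)) ^ 2 / (4 * δ) := by positivity
  linarith

variable [DecidableEq ι]

lemma exists_eq_transpose_mul_self {S : Matrix ι ι ℝ} (hS : S.PosDef) :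
    ∃ B : Matrix ι ι ℝ, S = Bᵀ * B ∧ B.det ≠ 0 := by
  obtain ⟨B, hB⟩ := CStarAlgebra.nonneg_iff_eq_star_mul_self.1 hS.posSemidef.nonneg
  rw [star_eq_conjTranspose, conjTranspose_eq_transpose_of_trivial] at hB
  refine ⟨B, hB, fun h => hS.det_pos.ne' ?_⟩
  rw [hB, det_mul, h, mul_zero]

/-- The substitution `w = B y`, where `S = Bᵗ B`, turns the Gaussian of `S` into the standard
one. -/
lemma gauss_eq_comp {S B : Matrix ι ι ℝ} (hSB : S = Bᵀ * B) (hB : B.det ≠ 0) (b : ℂ) (c : ι → ℂ)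
    (y : ι → ℝ) :
    gauss S b c y = Complex.exp (-b * ∑ i, ((toLin' B y i : ℝ) : ℂ) ^ 2 +
      ∑ i, (c ᵥ* (B⁻¹).map (algebraMap ℝ ℂ)) i * ((toLin' B y i : ℝ) : ℂ)) := by
  rw [gauss, hSB, cbil_transpose_mul_self]
  simp only [toLin'_apply]
  congr 2
  have h : (fun i => (((B *ᵥ y) i : ℝ) : ℂ)) = B.map (algebraMap ℝ ℂ) *ᵥ fun i => (y i : ℂ) := by
    ext i; simp [mulVec, dotProduct]
  change c ⬝ᵥ _ = (c ᵥ* (B⁻¹).map (algebraMap ℝ ℂ)) ⬝ᵥ fun i => (((B *ᵥ y) i : ℝ) : ℂ)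
  rw [h, ← dotProduct_mulVec, mulVec_mulVec, ← Matrix.map_mul, nonsing_inv_mul _ hB.isUnit]
  simp

lemma integrable_gauss {S : Matrix ι ι ℝ} (hS : S.PosDef) {b : ℂ} (hb : 0 < b.re) (c : ι → ℂ) :
    Integrable (gauss S b c) := by
  obtain ⟨B, hSB, hB⟩ := exists_eq_transpose_mul_self hS
  have h1 := GaussianFourier.integrable_cexp_neg_mul_sum_add hb (c ᵥ* (B⁻¹).map (algebraMap ℝ ℂ))
  have h2 := h1.smul_measure (c := ENNReal.ofReal |B.det⁻¹|) ENNReal.ofReal_ne_top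
  rw [← Real.map_matrix_volume_pi_eq_smul_volume_pi hB] at h2
  have h3 := h2.comp_measurable (LinearMap.continuous_of_finiteDimensional (toLin' B)).measurable
  exact h3.congr (Filter.Eventually.of_forall fun y => (gauss_eq_comp hSB hB b c y).symm)

lemma integral_gauss {S : Matrix ι ι ℝ} (hS : S.PosDef) {b : ℂ} (hb : 0 < b.re) (c : ι → ℂ) :
    ∫ y, gauss S b c y = ((√S.det : ℝ) : ℂ)⁻¹ * (Real.pi / b) ^ (Fintype.card ι / 2 : ℂ) *
      Complex.exp (cbil S⁻¹ c c / (4 * b)) := by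
  obtain ⟨B, hSB, hB⟩ := exists_eq_transpose_mul_self hS
  have h1 := GaussianFourier.integral_cexp_neg_mul_sum_add hb (c ᵥ* (B⁻¹).map (algebraMap ℝ ℂ))
  set g : (ι → ℝ) → ℂ := fun v => Complex.exp (-b * ∑ i, (v i : ℂ) ^ 2 +
    ∑ i, (c ᵥ* (B⁻¹).map (algebraMap ℝ ℂ)) i * (v i : ℂ)) with hg
  have h2 : ∫ y, gauss S b c y = ∫ y, g (toLin' B y) :=
    integral_congr_ae (Filter.Eventually.of_forall fun y => gauss_eq_comp hSB hB b c y)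
  have hgc : Continuous g := by simp only [hg]; fun_prop
  rw [h2, ← integral_map
    (LinearMap.continuous_of_finiteDimensional (toLin' B)).measurable.aemeasurable
    hgc.aestronglyMeasurable, Real.map_matrix_volume_pi_eq_smul_volume_pi hB, integral_smul_measure,
    h1, ENNReal.toReal_ofReal (abs_nonneg _)]
  have h3 : √S.det = |B.det| := by
    rw [hSB, det_mul, det_transpose, Real.sqrt_mul_self_eq_abs]
  have h4 : ∑ i, (c ᵥ* (B⁻¹).map (algebraMap ℝ ℂ)) i ^ 2 = cbil S⁻¹ c c := by
    rw [hSB, Matrix.mul_inv_rev, cbil, Matrix.map_mul, ← mulVec_mulVec, dotProduct_mulVec,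
      ← transpose_nonsing_inv, transpose_map, mulVec_transpose]
    simp [dotProduct, pow_two]
  rw [h4, h3, abs_inv, Complex.real_smul]
  push_cast; ring

lemma exists_pos_mul_norm_sq_le {S : Matrix ι ι ℝ} (hS : S.PosDef) :
    ∃ δ > 0, ∀ y : ι → ℝ, δ * ‖y‖ ^ 2 ≤ y ⬝ᵥ S *ᵥ y := by
  obtain ⟨B, hSB, hB⟩ := exists_eq_transpose_mul_self hS
  set K := ‖LinearMap.toContinuousLinearMap (toLin' B⁻¹)‖ with hK
  refine ⟨((K + 1) ^ 2)⁻¹, by positivity, fun y => ?_⟩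
  have h1 : ‖y‖ ≤ K * ‖B *ᵥ y‖ := by
    have := (LinearMap.toContinuousLinearMap (toLin' B⁻¹)).le_opNorm (B *ᵥ y)
    simpa [mulVec_mulVec, nonsing_inv_mul _ hB.isUnit] using this
  have h2 : y ⬝ᵥ S *ᵥ y = ∑ i, (B *ᵥ y) i ^ 2 := by
    rw [hSB, ← mulVec_mulVec, dotProduct_mulVec, vecMul_transpose]
    simp [dotProduct, pow_two]
  have h3 : ‖B *ᵥ y‖ ≤ √(∑ i, (B *ᵥ y) i ^ 2) := by
    refine (pi_norm_le_iff_of_nonneg (Real.sqrt_nonneg _)).2 fun i => ?_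
    rw [Real.norm_eq_abs]
    refine Real.abs_le_sqrt (Finset.single_le_sum (f := fun i => (B *ᵥ y) i ^ 2)
      (fun i _ => sq_nonneg _) (Finset.mem_univ i))
  have h0 : 0 ≤ ∑ i, (B *ᵥ y) i ^ 2 := Finset.sum_nonneg fun i _ => sq_nonneg _
  rw [h2, inv_mul_le_iff₀ (by positivity)]
  have h4 : ‖y‖ ≤ (K + 1) * √(∑ i, (B *ᵥ y) i ^ 2) := by
    have : 0 ≤ K := norm_nonneg _
    nlinarith [norm_nonneg (B *ᵥ y), Real.sqrt_nonneg (∑ i, (B *ᵥ y) i ^ 2)]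
  calc ‖y‖ ^ 2 ≤ ((K + 1) * √(∑ i, (B *ᵥ y) i ^ 2)) ^ 2 := by gcongr
    _ = _ := by rw [mul_pow, Real.sq_sqrt h0]

/-- Gaussians decay faster than any exponential. -/
lemma exists_norm_gauss_le {S : Matrix ι ι ℝ} (hS : S.PosDef) {b : ℂ} (hb : 0 < b.re)
    (c : ι → ℂ) (R : ℝ) : ∃ C, ∀ y, ‖gauss S b c y‖ ≤ C * Real.exp (-(R * ‖y‖)) := by
  obtain ⟨δ, hδ, h⟩ := exists_pos_mul_norm_sq_le hS
  refine ⟨_, fun y => le_trans ?_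
    (exp_neg_sq_add_le (mul_pos hb hδ) (∑ i, ‖c i‖) R ‖y‖)⟩
  rw [gauss, Complex.norm_exp, Real.exp_le_exp, cbil_ofReal, Complex.add_re]
  have h1 : (-b * ((y ⬝ᵥ S *ᵥ y : ℝ) : ℂ)).re = -b.re * (y ⬝ᵥ S *ᵥ y) := by
    simp [Complex.mul_re]
  have h2 : (∑ i, c i * (y i : ℂ)).re ≤ (∑ i, ‖c i‖) * ‖y‖ := by
    refine (Complex.re_le_norm _).trans ((norm_sum_le _ _).trans ?_)
    rw [Finset.sum_mul]
    refine Finset.sum_le_sum fun i _ => ?_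
    rw [norm_mul, Complex.norm_real]
    gcongr
    exact norm_le_pi_norm y i
  rw [h1]
  have := mul_le_mul_of_nonneg_left (h y) hb.le
  nlinarith

lemma summable_norm_gauss {S : Matrix ι ι ℝ} (hS : S.PosDef) {b : ℂ} (hb : 0 < b.re)
    (c : ι → ℂ) : Summable fun l : ι → ℤ => ‖gauss S b c fun i => (l i : ℝ)‖ := by
  obtain ⟨C, hC⟩ := exists_norm_gauss_le hS hb c 1
  simp only [one_mul] at hC
  exact Summable.of_nonneg_of_le (fun _ => norm_nonneg _) (fun l => hC _)
    (summable_exp_neg_norm.mul_left C)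

/-- Poisson summation for Gaussians: the sum over the shifted lattice `x + ℤ^ι` is a sum of Gaussians
of the inverse matrix. -/
theorem hasSum_gauss {S : Matrix ι ι ℝ} (hS : S.PosDef) {b : ℂ} (hb : 0 < b.re) (c : ι → ℂ)
    (x : ι → ℝ) :
    HasSum (fun n : ι → ℤ => ((√S.det : ℝ) : ℂ)⁻¹ * (Real.pi / b) ^ (Fintype.card ι / 2 : ℂ) *
      Complex.exp (cbil S⁻¹ (c - (2 * Real.pi * Complex.I) • fun i => (n i : ℂ))
        (c - (2 * Real.pi * Complex.I) • fun i => (n i : ℂ)) / (4 * b)) *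
        Complex.exp (2 * Real.pi * Complex.I * ∑ i, (n i : ℂ) * (x i : ℂ)))
      (∑' l : ι → ℤ, gauss S b c (x + fun i => (l i : ℝ))) := by
  obtain ⟨C, hC⟩ := exists_norm_gauss_le hS hb c 1
  simp only [one_mul] at hC
  have hint : ∀ n : ι → ℤ,
      ∫ y, Complex.exp (-(2 * Real.pi * Complex.I * ∑ i, (n i : ℂ) * (y i : ℂ))) * gauss S b c y =
      ((√S.det : ℝ) : ℂ)⁻¹ * (Real.pi / b) ^ (Fintype.card ι / 2 : ℂ) *
      Complex.exp (cbil S⁻¹ (c - (2 * Real.pi * Complex.I) • fun i => (n i : ℂ))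
        (c - (2 * Real.pi * Complex.I) • fun i => (n i : ℂ)) / (4 * b)) := by
    intro n
    rw [← integral_gauss hS hb]
    congr 1; ext y
    rw [gauss, gauss, ← Complex.exp_add]
    congr 1
    simp only [Pi.sub_apply, Pi.smul_apply, smul_eq_mul, sub_mul, Finset.sum_sub_distrib,
      Finset.mul_sum]
    simp only [mul_assoc]
    ring
  have hb0 : b ≠ 0 := by rintro rfl; simp at hb
  -- as functions of `n`, the Fourier coefficients are again Gaussians, with matrix `S⁻¹`
  have hsum : Summable fun n : ι → ℤ =>
      ∫ y, Complex.exp (-(2 * Real.pi * Complex.I * ∑ i, (n i : ℂ) * (y i : ℂ))) *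
        gauss S b c y := by
    simp only [hint]
    refine Summable.mul_left _ ?_
    have hb' : 0 < ((Real.pi : ℂ) ^ 2 / b).re := by
      rw [← Complex.ofReal_pow, Complex.div_re]
      simp only [Complex.ofReal_re, Complex.ofReal_im, zero_mul, zero_div, add_zero]
      have := Complex.normSq_pos.2 hb0
      positivity
    have h1 := (summable_norm_gauss hS.inv hb' ((-(Real.pi * Complex.I / b)) •
      (c ᵥ* S⁻¹.map (algebraMap ℝ ℂ)))).of_norm
    refine (h1.mul_left (Complex.exp (cbil S⁻¹ c c / (4 * b)))).congr fun n => ?_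
    rw [gauss, ← Complex.exp_add]
    congr 1
    have h2 : ∑ i, ((-(Real.pi * Complex.I / b)) • (c ᵥ* S⁻¹.map (algebraMap ℝ ℂ))) i *
        (((n i : ℤ) : ℝ) : ℂ) = -(Real.pi * Complex.I / b) * cbil S⁻¹ c (fun i => (n i : ℂ)) := by
      rw [cbil_eq_sum, Finset.mul_sum]
      simp [mul_assoc]
    rw [h2, sub_eq_add_neg, ← neg_smul, cbil_add_left, cbil_add_right, cbil_add_right,
      cbil_smul_left, cbil_smul_right, cbil_smul_left, cbil_smul_right,
      cbil_comm (posDef_transpose_eq hS.inv) (fun i => (n i : ℂ)) c]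
    simp only [Complex.ofReal_intCast]
    field_simp
    ring_nf
    rw [Complex.I_sq]
    ring
  have := poisson_summation (continuous_gauss S b c) (integrable_gauss hS hb c) hC hsum x
  simpa only [hint] using this

end QuadTheta

/-! ### The Jacobi theta series of an integral quadratic form -/

namespace QuadTheta
open MeasureTheory Matrix

section lattice

variable {f : ℕ} (Q : QuadraticForm ℤ (Fin f → ℤ))

lemma polar_eq (x y : Fin f → ℤ) : QuadraticMap.polar Q x y = x ⬝ᵥ gram Q *ᵥ y := by
  have h : gram Q = LinearMap.toMatrix₂' ℤ (QuadraticMap.polarBilin Q) := by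
    ext i j; simp [gram, LinearMap.toMatrix₂'_apply]
  rw [h, ← Matrix.toLinearMap₂'_apply', Matrix.toLinearMap₂'_toMatrix']
  rfl

lemma map_add_eq (x y : Fin f → ℤ) : Q (x + y) = Q x + Q y + x ⬝ᵥ gram Q *ᵥ y := by
  rw [← polar_eq, QuadraticMap.polar]; ring

lemma two_mul_apply (x : Fin f → ℤ) : 2 * Q x = x ⬝ᵥ gram Q *ᵥ x := by
  rw [← polar_eq, QuadraticMap.polar_self]; simp

lemma gram_transpose : (gram Q)ᵀ = gram Q := by
  ext i j; simp [gram, QuadraticMap.polar_comm]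

/-- The Gram matrix of `Q`, as a real matrix. -/
def gramR : Matrix (Fin f) (Fin f) ℝ := (gram Q).map (Int.cast : ℤ → ℝ)

lemma gramR_intCast (m n : Fin f → ℤ) :
    (fun i => (m i : ℝ)) ⬝ᵥ gramR Q *ᵥ (fun i => (n i : ℝ)) = ((m ⬝ᵥ gram Q *ᵥ n : ℤ) : ℝ) := by
  simp [gramR, dotProduct, mulVec]

lemma det_gramR : (gramR Q).det = ((gram Q).det : ℝ) := by
  exact ((Int.castRingHom ℝ).map_det (gram Q)).symm

variable {Q}

lemma det_gram_ne_zero (hQ : Q.PosDef) : (gram Q).det ≠ 0 := by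
  intro h
  obtain ⟨v, hv, h0⟩ := Matrix.exists_mulVec_eq_zero_iff.2 h
  have h1 := two_mul_apply Q v
  rw [h0, dotProduct_zero] at h1
  have := hQ v hv
  omega

/-- Positivity on integer vectors passes to rational vectors by homogeneity and to real vectors, as
semidefiniteness, by density. Definiteness follows because the determinant is not zero. -/
lemma posDef_gramR (hQ : Q.PosDef) : (gramR Q).PosDef := by
  have hs : (gramR Q).IsHermitian := by
    rw [IsHermitian, conjTranspose_eq_transpose_of_trivial, gramR, ← transpose_map,
      gram_transpose]
  have hpsd : (gramR Q).PosSemidef := by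
    refine .of_dotProduct_mulVec_nonneg hs fun y => ?_
    rw [star_trivial]
    -- approximate `y` by the rational vectors `⌊k y⌋ / k`
    have ht : Filter.Tendsto (fun k : ℕ => fun i => ((⌊(k : ℝ) * y i⌋ : ℤ) : ℝ) / k) Filter.atTop
        (nhds y) := by
      refine tendsto_pi_nhds.2 fun i => ?_
      rw [tendsto_iff_dist_tendsto_zero]
      refine squeeze_zero' (Filter.Eventually.of_forall fun k => dist_nonneg) ?_
        (tendsto_inv_atTop_nhds_zero_nat (𝕜 := ℝ))
      filter_upwards [Filter.eventually_gt_atTop 0] with k hk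
      have hk' : (0 : ℝ) < k := by exact_mod_cast hk
      have h1 := Int.floor_le ((k : ℝ) * y i)
      have h2 := Int.lt_floor_add_one ((k : ℝ) * y i)
      have h3 : ((⌊(k : ℝ) * y i⌋ : ℤ) : ℝ) / k - y i =
          (((⌊(k : ℝ) * y i⌋ : ℤ) : ℝ) - k * y i) / k := by field_simp
      rw [Real.dist_eq, h3, abs_div, abs_of_pos hk', div_le_iff₀ hk', inv_mul_cancel₀ hk'.ne',
        abs_le]
      constructor <;> linarith
    have hc : Continuous fun y : Fin f → ℝ => y ⬝ᵥ gramR Q *ᵥ y := by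
      unfold dotProduct mulVec dotProduct; fun_prop
    refine ge_of_tendsto' ((hc.tendsto y).comp ht) fun k => ?_
    have h1 : (fun i => ((⌊(k : ℝ) * y i⌋ : ℤ) : ℝ) / k) =
        (k : ℝ)⁻¹ • fun i => ((⌊(k : ℝ) * y i⌋ : ℤ) : ℝ) := by
      ext i; simp [div_eq_inv_mul]
    have h2 := gramR_intCast Q (fun i => ⌊(k : ℝ) * y i⌋) (fun i => ⌊(k : ℝ) * y i⌋)
    rw [← two_mul_apply] at h2
    simp only [Function.comp, h1, smul_dotProduct, mulVec_smul, dotProduct_smul, h2, smul_eq_mul]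
    have := hQ.nonneg (fun i => ⌊(k : ℝ) * y i⌋)
    positivity
  rw [hpsd.posDef_iff_det_ne_zero, det_gramR]
  exact_mod_cast det_gram_ne_zero hQ

variable (Q)

/-- The term of index `m` of the Jacobi theta series of `Q`. -/
noncomputable def jterm (τ : ℂ) (u : Fin f → ℂ) (m : Fin f → ℤ) : ℂ :=
  Complex.exp (2 * Real.pi * Complex.I * ((Q m : ℂ) * τ + ∑ i, u i * (m i : ℂ)))

/-- The Jacobi theta series `∑ₘ e(Q(m) τ + u · m)` of `Q`. The elliptic variable `u` is dual to
`m`: it stands for `u = A z`, so that `u · m = ⟨z, m⟩`. -/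
noncomputable def jtheta (τ : ℂ) (u : Fin f → ℂ) : ℂ := ∑' m : Fin f → ℤ, jterm Q τ u m

lemma jterm_eq_gauss (τ : ℂ) (u : Fin f → ℂ) (m : Fin f → ℤ) :
    jterm Q τ u m = gauss (gramR Q) (-(Real.pi * Complex.I * τ))
      ((2 * Real.pi * Complex.I) • u) fun i => (m i : ℝ) := by
  rw [jterm, gauss, cbil_ofReal, gramR_intCast, ← two_mul_apply]
  congr 1
  simp only [Pi.smul_apply, smul_eq_mul, mul_assoc, ← Finset.mul_sum, mul_add]
  push_cast; ring

lemma re_neg_pi_I_mul {τ : ℂ} (hτ : 0 < τ.im) : 0 < (-(Real.pi * Complex.I * τ)).re := by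
  simp [Complex.mul_re, Complex.mul_im]; positivity

variable {Q}

lemma summable_norm_jterm (hQ : Q.PosDef) {τ : ℂ} (hτ : 0 < τ.im) (u : Fin f → ℂ) :
    Summable fun m => ‖jterm Q τ u m‖ := by
  simp only [jterm_eq_gauss]
  exact summable_norm_gauss (posDef_gramR hQ) (re_neg_pi_I_mul hτ) _

variable (Q)

lemma jtheta_neg (τ : ℂ) (u : Fin f → ℂ) : jtheta Q τ (-u) = jtheta Q τ u := by
  rw [jtheta, ← (Equiv.neg (Fin f → ℤ)).tsum_eq]
  refine tsum_congr fun m => ?_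
  simp [jterm, QuadraticMap.map_neg]

lemma jterm_add_intCast (τ : ℂ) (k : ℤ) (u : Fin f → ℂ) (m : Fin f → ℤ) :
    jterm Q (τ + k) u m = jterm Q τ u m := by
  rw [jterm, jterm, Complex.exp_eq_exp_iff_exists_int]
  exact ⟨Q m * k, by push_cast; ring⟩

lemma jtheta_add_intCast (τ : ℂ) (k : ℤ) (u : Fin f → ℂ) :
    jtheta Q (τ + k) u = jtheta Q τ u :=
  tsum_congr fun m => jterm_add_intCast Q τ k u m

end lattice

/-- As `t → ∞`, a series `∑ h(n) exp (-π t nᵗ T n)` with bounded coefficients tends to its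
constant term. -/
lemma tendsto_tsum_mul_exp_neg {ι : Type*} [Fintype ι] [DecidableEq ι] {T : Matrix ι ι ℝ}
    (hT : T.PosDef) (h : (ι → ℤ) → ℂ) {K : ℝ} (hK : ∀ n, ‖h n‖ ≤ K) :
    Filter.Tendsto (fun t : ℝ => ∑' n : ι → ℤ, h n *
      Complex.exp (-(Real.pi * t) * cbil T (fun i => (n i : ℂ)) fun i => (n i : ℂ)))
      Filter.atTop (nhds (h 0)) := by
  have hq : ∀ n : ι → ℤ, cbil T (fun i => (n i : ℂ)) (fun i => (n i : ℂ)) =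
      (((fun i => (n i : ℝ)) ⬝ᵥ T *ᵥ fun i => (n i : ℝ) : ℝ) : ℂ) := by
    intro n; rw [← cbil_ofReal]; simp
  set q : (ι → ℤ) → ℝ := fun n => (fun i => (n i : ℝ)) ⬝ᵥ T *ᵥ fun i => (n i : ℝ) with hqd
  have hq0 : ∀ n, 0 ≤ q n := fun n => by
    simpa using hT.posSemidef.dotProduct_mulVec_nonneg fun i => (n i : ℝ)
  have hnorm : ∀ (t : ℝ) (n : ι → ℤ), ‖Complex.exp (-(Real.pi * t) *
      cbil T (fun i => (n i : ℂ)) fun i => (n i : ℂ))‖ = Real.exp (-(Real.pi * t) * q n) := by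
    intro t n
    rw [hq, Complex.norm_exp]
    congr 1
    rw [← Complex.ofReal_mul, ← Complex.ofReal_neg, ← Complex.ofReal_mul, Complex.ofReal_re]
  have hlim : ∑' n : ι → ℤ, (if n = 0 then h n else 0) = h 0 := by
    rw [tsum_ite_eq]
  rw [← hlim]
  have hs : Summable fun n : ι → ℤ => K * Real.exp (-Real.pi * q n) := by
    refine Summable.mul_left _ ?_
    have h1 := summable_norm_gauss hT (b := (Real.pi : ℂ)) (by simpa using Real.pi_pos) 0
    refine h1.congr fun n => ?_
    have := hnorm 1 n
    rw [gauss]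
    simpa using this
  refine tendsto_tsum_of_dominated_convergence hs (fun n => ?_) ?_
  · split_ifs with hn
    · subst hn
      simp [cbil, ← Pi.zero_def]
    · have hpos : 0 < q n := by
        have : (fun i => (n i : ℝ)) ≠ 0 := by
          intro h0; apply hn; ext i; simpa using congrFun h0 i
        simpa using hT.dotProduct_mulVec_pos this
      rw [tendsto_zero_iff_norm_tendsto_zero]
      simp only [norm_mul, hnorm]
      rw [← mul_zero ‖h n‖]
      refine Filter.Tendsto.const_mul _ (Real.tendsto_exp_atBot.comp ?_)
      have : ∀ t : ℝ, -(Real.pi * t) * q n = -((Real.pi * q n) * t) := fun t => by ring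
      simp only [this]
      exact Filter.tendsto_neg_atTop_atBot.comp
        (Filter.tendsto_id.const_mul_atTop (mul_pos Real.pi_pos hpos))
  · filter_upwards [Filter.eventually_ge_atTop (1 : ℝ)] with t ht n
    rw [norm_mul, hnorm]
    refine mul_le_mul (hK n) ?_ (Real.exp_pos _).le ((norm_nonneg _).trans (hK n))
    rw [Real.exp_le_exp]
    have := mul_nonneg Real.pi_pos.le (hq0 n)
    nlinarith

end QuadTheta

/-! ### Inversion of the theta series -/

namespace QuadTheta
open Matrix

section residues

variable {ι : Type*} (c : ℕ) [NeZero c]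

/-- Euclidean division of integer vectors by `c`: the pair `(g, l)` stands for `g + c l`, where the
entries of `g` are represented by integers in `[0, c)`. -/
def residueEquiv : (ι → ZMod c) × (ι → ℤ) ≃ (ι → ℤ) where
  toFun p i := ((p.1 i).val : ℤ) + c * p.2 i
  invFun m := (fun i => (m i : ZMod c), fun i => m i / c)
  left_inv p := by
    have hc : (c : ℤ) ≠ 0 := by exact_mod_cast NeZero.ne c
    ext i
    · simp
    · have h1 : ((p.1 i).val : ℤ) / c = 0 :=
        Int.ediv_eq_zero_of_lt (by positivity) (by exact_mod_cast ZMod.val_lt (p.1 i))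
      change (((p.1 i).val : ℤ) + c * p.2 i) / c = p.2 i
      rw [Int.add_mul_ediv_left _ _ hc, h1, zero_add]
  right_inv m := by
    ext i
    simp only [ZMod.val_intCast]
    exact Int.emod_add_mul_ediv (m i) c

variable {c} in
/-- A sum over residue classes of a function periodic modulo `c` is invariant under translation. -/
lemma sum_residue_shift [Fintype ι] [DecidableEq ι] {h : (ι → ℤ) → ℂ}
    (hh : ∀ m m' : ι → ℤ, (∀ i, (m i : ZMod c) = (m' i : ZMod c)) → h m = h m') (s : ι → ℤ) :
    ∑ g : ι → ZMod c, h (fun i => ((g i).val : ℤ)) =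
      ∑ g : ι → ZMod c, h ((fun i => ((g i).val : ℤ)) + s) := by
  rw [← Equiv.sum_comp (Equiv.addRight fun i => (s i : ZMod c))]
  refine Finset.sum_congr rfl fun g _ => hh _ _ fun i => ?_
  simp

end residues

section

variable {f : ℕ} (Q : QuadraticForm ℤ (Fin f → ℤ))

lemma intCast_apply_eq {c : ℕ} {m m' : Fin f → ℤ}
    (h : ∀ i, (m i : ZMod c) = (m' i : ZMod c)) : ((Q m : ℤ) : ZMod c) = (Q m' : ℤ) := by
  have h1 : ∀ i, ∃ k : ℤ, m' i = m i + c * k := fun i => by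
    obtain ⟨k, hk⟩ := (ZMod.intCast_eq_intCast_iff_dvd_sub _ _ _).1 (h i)
    exact ⟨k, by linarith⟩
  choose k hk using h1
  have h2 : m' = m + (c : ℤ) • k := by ext i; simp [hk]
  rw [h2, map_add_eq, QuadraticMap.map_smul, mulVec_smul, dotProduct_smul]
  simp

/-- The quadratic exponential sum `∑ e((a Q(g) + n · g) / c)` over the vectors `g` modulo `c`. The
linear term uses the standard dot product, so that `n` stands for the dual vector `A⁻¹ n`. -/
noncomputable def expSum (a : ℤ) (c : ℕ) [NeZero c] (n : Fin f → ℤ) : ℂ :=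
  ∑ g : Fin f → ZMod c, ZMod.stdAddChar (N := c)
    ((a * Q (fun i => ((g i).val : ℤ)) + n ⬝ᵥ (fun i => ((g i).val : ℤ)) : ℤ) : ZMod c)

end

variable {r : ℕ} {Q : QuadraticForm ℤ (Fin (2 * r) → ℤ)}

/-- For a matrix `(a b; c d)` of determinant one with `c > 0`, Poisson summation over each residue
class modulo `c` expresses the theta series at `(a τ + b) / (c τ + d)` by a theta series over the
dual lattice. The dual vector `A⁻¹ n` is represented by the integer vector `n`. -/
theorem jtheta_inversion (hQ : Q.PosDef) {a b d : ℤ} {c : ℕ} [NeZero c] (hdet : a * d - b * c = 1)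
    {τ : ℂ} (hτ : 0 < τ.im) (u : Fin (2 * r) → ℂ) :
    jtheta Q ((a * τ + b) / (c * τ + d)) ((c * τ + d)⁻¹ • u) =
      ((√(gramR Q).det : ℝ) : ℂ)⁻¹ * ((c * τ + d) / (c * Complex.I)) ^ r *
      Complex.exp (Real.pi * Complex.I * c * cbil (gramR Q)⁻¹ u u / (c * τ + d)) *
      ∑' n : Fin (2 * r) → ℤ, Complex.exp (Real.pi * Complex.I *
        ((τ + d / c) * cbil (gramR Q)⁻¹ (fun i => (n i : ℂ)) (fun i => (n i : ℂ)) -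
          2 * cbil (gramR Q)⁻¹ u (fun i => (n i : ℂ)))) * expSum Q a c n := by
  have hc : (0 : ℝ) < c := by exact_mod_cast NeZero.pos c
  have hc0 : (c : ℂ) ≠ 0 := by exact_mod_cast NeZero.ne c
  set T : ℂ := c * τ + d with hT
  have hTim : T.im = c * τ.im := by simp [hT]
  have hTim' : 0 < T.im := by rw [hTim]; positivity
  have hT0 : T ≠ 0 := by rintro h; rw [h] at hTim'; simp at hTim'
  have hpi : (Real.pi : ℂ) ≠ 0 := by exact_mod_cast Real.pi_ne_zero
  have hγ : (a * τ + b) / T = a / c - 1 / (c * T) := by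
    have : (a : ℂ) * d - b * c = 1 := by exact_mod_cast hdet
    field_simp
    rw [hT]; linear_combination -this
  have hdetpos := (posDef_gramR hQ).det_pos
  set b0 : ℂ := Real.pi * Complex.I * c / T with hb0
  have hb0ne : b0 ≠ 0 := by
    rw [hb0]; exact div_ne_zero (mul_ne_zero (mul_ne_zero hpi Complex.I_ne_zero) hc0) hT0
  have hb0re : 0 < b0.re := by
    have : b0.re = Real.pi * c * T.im / Complex.normSq T := by
      rw [hb0, Complex.div_re]; simp [Complex.mul_re, Complex.mul_im]
    rw [this]
    have := Complex.normSq_pos.2 hT0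
    have := Real.pi_pos
    positivity
  set c0 : Fin (2 * r) → ℂ := (2 * Real.pi * Complex.I) • ((c / T) • u) with hc0d
  -- each term of the theta series is a character value times a Gaussian
  have hterm : ∀ (g : Fin (2 * r) → ZMod c) (l : Fin (2 * r) → ℤ),
      jterm Q ((a * τ + b) / T) (T⁻¹ • u) (residueEquiv c (g, l)) =
      ZMod.stdAddChar (N := c) ((a * Q (fun i => ((g i).val : ℤ)) : ℤ) : ZMod c) *
        gauss (gramR Q) b0 c0 ((fun i => ((g i).val : ℝ) / c) + fun i => (l i : ℝ)) := by
    intro g l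
    set m := residueEquiv c (g, l) with hm
    have hmi : ∀ i, m i = ((g i).val : ℤ) + c * l i := fun i => rfl
    have h1 : ((a * Q (fun i => ((g i).val : ℤ)) : ℤ) : ZMod c) = ((a * Q m : ℤ) : ZMod c) := by
      push_cast
      rw [intCast_apply_eq Q (m' := m) fun i => by simp [hmi]]
    have h2 : ((fun i => ((g i).val : ℝ) / c) + fun i => (l i : ℝ)) =
        (c : ℝ)⁻¹ • fun i => (m i : ℝ) := by
      ext i; simp only [Pi.add_apply, Pi.smul_apply, hmi, smul_eq_mul]; push_cast; field_simp
    have h3 : (((c : ℝ)⁻¹ • fun i => (m i : ℝ)) ⬝ᵥ gramR Q *ᵥ ((c : ℝ)⁻¹ • fun i => (m i : ℝ))) =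
        (c : ℝ)⁻¹ ^ 2 * (2 * Q m) := by
      rw [smul_dotProduct, mulVec_smul, dotProduct_smul, gramR_intCast, ← two_mul_apply]
      push_cast; simp only [smul_eq_mul]; ring
    rw [h1, ZMod.stdAddChar_coe, h2, gauss, cbil_ofReal, h3, ← Complex.exp_add, jterm, hγ]
    congr 1
    have h4 : ∑ i, c0 i * ((((c : ℝ)⁻¹ • fun i => (m i : ℝ)) i : ℝ) : ℂ) =
        2 * Real.pi * Complex.I * ∑ i, (T⁻¹ • u) i * (m i : ℂ) := by
      rw [Finset.mul_sum]
      refine Finset.sum_congr rfl fun i _ => ?_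
      simp only [hc0d, Pi.smul_apply, smul_eq_mul]; push_cast; field_simp
    rw [h4, hb0]
    push_cast
    field_simp
    ring
  have hγim : 0 < ((a * τ + b) / T).im := by
    rw [hγ, Complex.sub_im]
    have h1 : ((a : ℂ) / c).im = 0 := by
      rw [← Complex.ofReal_intCast, ← Complex.ofReal_natCast, ← Complex.ofReal_div,
        Complex.ofReal_im]
    have h2 : ((1 : ℂ) / (c * T)).im = -(c * T.im) / Complex.normSq (c * T) := by
      rw [one_div, Complex.inv_im]; simp
    have h3 := Complex.normSq_pos.2 (mul_ne_zero hc0 hT0)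
    rw [h1, h2, zero_sub, neg_div, neg_neg]
    positivity
  have hsumm : Summable fun p => jterm Q ((a * τ + b) / T) (T⁻¹ • u) (residueEquiv c p) :=
    (residueEquiv c).summable_iff.2 (summable_norm_jterm hQ hγim _).of_norm
  rw [jtheta, ← (residueEquiv c).tsum_eq, hsumm.tsum_prod, tsum_fintype]
  simp only [hterm, tsum_mul_left]
  -- Poisson summation in each residue class
  have hP := fun g : Fin (2 * r) → ZMod c =>
    (hasSum_gauss (posDef_gramR hQ) hb0re c0 fun i => ((g i).val : ℝ) / c).mul_left
      (ZMod.stdAddChar (N := c) ((a * Q (fun i => ((g i).val : ℤ)) : ℤ) : ZMod c))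
  have hPs := hasSum_sum fun g (_ : g ∈ Finset.univ) => hP g
  rw [← hPs.tsum_eq, ← tsum_mul_left]
  refine tsum_congr fun n => ?_
  have hpow : ((Real.pi : ℂ) / b0) ^ ((Fintype.card (Fin (2 * r)) : ℂ) / 2) =
      (T / (c * Complex.I)) ^ r := by
    have h1 : ((Fintype.card (Fin (2 * r)) : ℂ) / 2) = (r : ℂ) := by simp
    rw [h1, Complex.cpow_natCast, hb0]
    congr 1
    field_simp
  rw [hpow, expSum, Finset.mul_sum, Finset.mul_sum]
  refine Finset.sum_congr rfl fun g _ => ?_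
  have hexp : Complex.exp (cbil (gramR Q)⁻¹ (c0 - (2 * Real.pi * Complex.I) • fun i => (n i : ℂ))
      (c0 - (2 * Real.pi * Complex.I) • fun i => (n i : ℂ)) / (4 * b0)) =
      Complex.exp (Real.pi * Complex.I * c * cbil (gramR Q)⁻¹ u u / T) *
      Complex.exp (Real.pi * Complex.I *
        ((τ + d / c) * cbil (gramR Q)⁻¹ (fun i => (n i : ℂ)) (fun i => (n i : ℂ)) -
          2 * cbil (gramR Q)⁻¹ u (fun i => (n i : ℂ)))) := by
    rw [← Complex.exp_add]
    congr 1
    have h1 : τ + d / c = T / c := by rw [hT]; field_simp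
    rw [h1, hc0d, sub_eq_add_neg, ← neg_smul, hb0]
    simp only [cbil_add_left, cbil_add_right, cbil_smul_left, cbil_smul_right]
    rw [cbil_comm (posDef_transpose_eq (posDef_gramR hQ).inv) (fun i => (n i : ℂ)) u]
    field_simp
    ring
  have hchar : Complex.exp (2 * Real.pi * Complex.I *
      ∑ i, (n i : ℂ) * ((((g i).val : ℝ) / c : ℝ) : ℂ)) =
      ZMod.stdAddChar (N := c) ((n ⬝ᵥ (fun i => ((g i).val : ℤ)) : ℤ) : ZMod c) := by
    rw [ZMod.stdAddChar_coe]
    congr 1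
    simp only [dotProduct]
    push_cast
    rw [Finset.mul_sum, Finset.mul_sum, Finset.sum_div]
    refine Finset.sum_congr rfl fun i _ => ?_
    ring
  rw [hexp, hchar, Int.cast_add, AddChar.map_add_eq_mul]
  ring

end QuadTheta

/-! ### The level and the support of the exponential sums -/

namespace QuadTheta
open Matrix

/-- A symmetric integer matrix with even diagonal only takes even values. -/
lemma even_dotProduct_mulVec {ι : Type*} [Fintype ι] {B : Matrix ι ι ℤ} (hs : Bᵀ = B)
    (hd : ∀ i, Even (B i i)) (k : ι → ℤ) : Even (k ⬝ᵥ B *ᵥ k) := by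
  rw [← ZMod.intCast_eq_zero_iff_even]
  have h1 : ((k ⬝ᵥ B *ᵥ k : ℤ) : ZMod 2) =
      ∑ p : ι × ι, (k p.1 : ZMod 2) * (B p.1 p.2 : ZMod 2) * (k p.2 : ZMod 2) := by
    rw [Fintype.sum_prod_type]
    simp [dotProduct, mulVec, Finset.mul_sum, mul_assoc]
  rw [h1]
  -- modulo two, the terms with indices `(i, j)` and `(j, i)` cancel
  refine Finset.sum_involution (fun p _ => p.swap) (fun p _ => ?_) (fun p _ hp h => hp ?_)
    (fun _ _ => Finset.mem_univ _) (fun _ _ => Prod.swap_swap _)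
  · have h2 : B p.2 p.1 = B p.1 p.2 := congrFun (congrFun hs p.1) p.2
    simp only [Prod.fst_swap, Prod.snd_swap, h2]
    have h3 : (2 : ZMod 2) = 0 := rfl
    linear_combination (k p.1 * B p.1 p.2 * k p.2 : ZMod 2) * h3
  · have h2 : p.2 = p.1 := congrArg Prod.fst h
    have h3 : ((B p.1 p.1 : ℤ) : ZMod 2) = 0 := ZMod.intCast_eq_zero_iff_even.2 (hd _)
    rw [h2, h3]; simp

section level

variable {f : ℕ} {Q : QuadraticForm ℤ (Fin f → ℤ)}

lemma det_gram_pos (hQ : Q.PosDef) : 0 < (gram Q).det := by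
  have := (posDef_gramR hQ).det_pos
  rw [det_gramR] at this
  exact_mod_cast this

lemma level_mem (hQ : Q.PosDef) : 0 < level Q ∧ ∃ B : Matrix (Fin f) (Fin f) ℤ,
    gram Q * B = (level Q : ℤ) • (1 : Matrix (Fin f) (Fin f) ℤ) ∧ ∀ i, Even (B i i) := by
  have hpos := det_gram_pos hQ
  refine Nat.sInf_mem (s := {N : ℕ | 0 < N ∧ ∃ B : Matrix (Fin f) (Fin f) ℤ,
    gram Q * B = (N : ℤ) • (1 : Matrix (Fin f) (Fin f) ℤ) ∧ ∀ i, Even (B i i)})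
    ⟨(2 * (gram Q).det).toNat, by omega, (2 : ℤ) • (gram Q).adjugate, ?_, fun i => by simp⟩
  rw [Int.toNat_of_nonneg (by omega), mul_smul_comm, mul_adjugate, smul_smul]

lemma level_pos (hQ : Q.PosDef) : 0 < level Q := (level_mem hQ).1

lemma exists_level_matrix (hQ : Q.PosDef) : ∃ B : Matrix (Fin f) (Fin f) ℤ,
    gram Q * B = (level Q : ℤ) • (1 : Matrix (Fin f) (Fin f) ℤ) ∧ Bᵀ = B ∧
      ∀ k, Even (k ⬝ᵥ B *ᵥ k) := by
  obtain ⟨hN, B, hB, hd⟩ := level_mem hQ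
  have hN' : (level Q : ℤ) ≠ 0 := by exact_mod_cast hN.ne'
  have h1 : Bᵀ * gram Q = (level Q : ℤ) • (1 : Matrix (Fin f) (Fin f) ℤ) := by
    have := congrArg transpose hB
    rwa [transpose_mul, gram_transpose, transpose_smul, transpose_one] at this
  have hs : Bᵀ = B := by
    have h2 : (level Q : ℤ) • Bᵀ = (level Q : ℤ) • B := by
      calc (level Q : ℤ) • Bᵀ = Bᵀ * (gram Q * B) := by rw [hB, mul_smul_comm, Matrix.mul_one]
        _ = (Bᵀ * gram Q) * B := (Matrix.mul_assoc _ _ _).symm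
        _ = _ := by rw [h1]; simp
    exact smul_right_injective _ hN' h2
  exact ⟨B, hB, hs, even_dotProduct_mulVec hs hd⟩

lemma not_dvd_det_of_not_dvd_level (hQ : Q.PosDef) {p : ℕ} (hp : p.Prime)
    (h : ¬ p ∣ level Q) : ¬ (p : ℤ) ∣ (gram Q).det := by
  obtain ⟨B, hB, -⟩ := exists_level_matrix hQ
  have h1 := congrArg det hB
  rw [det_mul, det_smul, det_one, mul_one, Fintype.card_fin] at h1
  intro h2
  have h3 : (p : ℤ) ∣ (level Q : ℤ) ^ f := h1 ▸ h2.mul_right _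
  exact h (by exact_mod_cast (Nat.prime_iff_prime_int.1 hp).dvd_of_dvd_pow h3)

/-- If an odd prime `p` divided the level but not the determinant, then `N / p` would also
satisfy the condition that defines the level. -/
lemma dvd_det_of_dvd_level (hQ : Q.PosDef) {p : ℕ} (hp : p.Prime) (hp2 : Odd p)
    (h : p ∣ level Q) : (p : ℤ) ∣ (gram Q).det := by
  by_contra hnd
  obtain ⟨hN, B, hB, hd⟩ := level_mem hQ
  obtain ⟨M, hM⟩ := h
  have hpZ := Nat.prime_iff_prime_int.1 hp
  have h1 : (gram Q).det • B = (level Q : ℤ) • (gram Q).adjugate := by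
    calc (gram Q).det • B = ((gram Q).adjugate * gram Q) * B := by
          rw [adjugate_mul]; simp
      _ = _ := by rw [Matrix.mul_assoc, hB, mul_smul_comm, Matrix.mul_one]
  have h2 : ∀ i j, ∃ b, B i j = p * b := fun i j => by
    have h3 := congrFun (congrFun h1 i) j
    simp only [Matrix.smul_apply, smul_eq_mul, hM] at h3
    have h4 : (p : ℤ) ∣ (gram Q).det * B i j := by
      rw [h3]; push_cast; exact Dvd.intro _ (mul_assoc _ _ _).symm
    exact (hpZ.dvd_or_dvd h4).resolve_left hnd
  choose B' hB' using h2
  have h3 : B = (p : ℤ) • Matrix.of B' := by ext i j; simp [hB']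
  have hp0 : (p : ℤ) ≠ 0 := by exact_mod_cast hp.ne_zero
  have hM0 : 0 < M := by rcases Nat.eq_zero_or_pos M with rfl | h <;> simp_all
  have h4 : M ∈ {N : ℕ | 0 < N ∧ ∃ B : Matrix (Fin f) (Fin f) ℤ,
      gram Q * B = (N : ℤ) • (1 : Matrix (Fin f) (Fin f) ℤ) ∧ ∀ i, Even (B i i)} := by
    refine ⟨hM0, Matrix.of B', ?_, fun i => ?_⟩
    · rw [h3, hM, mul_smul_comm] at hB
      refine smul_right_injective _ hp0 ?_
      simp only [hB, smul_smul]; push_cast; rfl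
    · have h5 := hd i
      rw [hB', Int.even_mul] at h5
      refine h5.resolve_left ?_
      rw [Int.not_even_iff_odd]; exact_mod_cast hp2
  have h5 : level Q ≤ M := Nat.sInf_le h4
  have := hp.two_le
  rw [hM] at h5
  nlinarith

end level

section expSum

variable {f : ℕ} {Q : QuadraticForm ℤ (Fin f → ℤ)} {a : ℤ} {c : ℕ} [NeZero c]

/-- Translating the summation variable by an integer vector `s`. -/
lemma expSum_eq_shift (Q : QuadraticForm ℤ (Fin f → ℤ)) (a : ℤ) (n s : Fin f → ℤ) :
    expSum Q a c n = ∑ g : Fin f → ZMod c, ZMod.stdAddChar (N := c)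
      ((a * Q ((fun i => ((g i).val : ℤ)) + s) +
        n ⬝ᵥ ((fun i => ((g i).val : ℤ)) + s) : ℤ) : ZMod c) := by
  refine sum_residue_shift (h := fun m => ZMod.stdAddChar (N := c)
    ((a * Q m + n ⬝ᵥ m : ℤ) : ZMod c)) (fun m m' h => ?_) s
  congr 1
  push_cast
  rw [intCast_apply_eq Q h]
  simp [dotProduct, h]

/-- Dual vectors `A m` of lattice vectors only change the exponential sum by a phase: translate the
summation variable by `-d m`. -/
lemma expSum_mulVec {d : ℤ} (had : ((a * d : ℤ) : ZMod c) = 1) (m : Fin f → ℤ) :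
    expSum Q a c (gram Q *ᵥ m) =
      ZMod.stdAddChar (N := c) ((-(d * Q m) : ℤ) : ZMod c) * expSum Q a c 0 := by
  rw [expSum_eq_shift Q a _ (-d • m), expSum, Finset.mul_sum]
  refine Finset.sum_congr rfl fun g _ => ?_
  rw [← AddChar.map_add_eq_mul]
  congr 1
  set x : Fin f → ℤ := fun i => ((g i).val : ℤ)
  have h1 : (gram Q *ᵥ m) ⬝ᵥ x = x ⬝ᵥ gram Q *ᵥ m := dotProduct_comm _ _
  have h2 : (gram Q *ᵥ m) ⬝ᵥ m = 2 * Q m := by rw [dotProduct_comm, two_mul_apply]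
  rw [map_add_eq, QuadraticMap.map_smul, mulVec_smul, dotProduct_smul, dotProduct_add,
    dotProduct_smul, h1, h2, zero_dotProduct]
  push_cast at had ⊢
  simp only [smul_eq_mul]
  push_cast
  linear_combination ((d * Q m : ZMod c) - ((x ⬝ᵥ gram Q *ᵥ m : ℤ) : ZMod c)) * had

/-- When `c` is a multiple of the level, the exponential sum is supported on the vectors `A m`
dual to lattice vectors. -/
lemma exists_mulVec_eq_of_expSum_ne_zero (hQ : Q.PosDef) (hc : level Q ∣ c) {n : Fin f → ℤ}
    (h : expSum Q a c n ≠ 0) : ∃ m, gram Q *ᵥ m = n := by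
  obtain ⟨B, hB, hs, he⟩ := exists_level_matrix hQ
  obtain ⟨e, rfl⟩ := hc
  have hN : (level Q : ℤ) ≠ 0 := by exact_mod_cast (level_pos hQ).ne'
  have he0 : (e : ℤ) ≠ 0 := by
    have := NeZero.ne (level Q * e)
    exact_mod_cast right_ne_zero_of_mul this
  -- translating by `e B k` multiplies the sum by a character value, which must be one
  have h1 : ∀ k : Fin f → ℤ, (level Q : ℤ) ∣ n ⬝ᵥ B *ᵥ k := by
    intro k
    have h2 : expSum Q a (level Q * e) n = ZMod.stdAddChar (N := level Q * e)
        ((e * (n ⬝ᵥ B *ᵥ k) : ℤ) : ZMod (level Q * e)) * expSum Q a (level Q * e) n := by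
      conv_lhs => rw [expSum_eq_shift Q a _ ((e : ℤ) • B *ᵥ k)]
      rw [expSum, Finset.mul_sum]
      refine Finset.sum_congr rfl fun g _ => ?_
      rw [← AddChar.map_add_eq_mul]
      congr 1
      set x : Fin f → ℤ := fun i => ((g i).val : ℤ)
      have h3 : gram Q *ᵥ B *ᵥ k = (level Q : ℤ) • k := by
        rw [mulVec_mulVec, hB, smul_mulVec, one_mulVec]
      obtain ⟨q, hq⟩ := he k
      have h4 : Q (B *ᵥ k) = level Q * q := by
        have h5 := two_mul_apply Q (B *ᵥ k)
        rw [h3, dotProduct_smul, dotProduct_comm, hq, smul_eq_mul] at h5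
        linarith
      rw [map_add_eq, QuadraticMap.map_smul, mulVec_smul, dotProduct_smul, dotProduct_add,
        dotProduct_smul, h3, h4, dotProduct_smul]
      have h6 : ((level Q : ℕ) : ZMod (level Q * e)) * ((e : ℕ) : ZMod (level Q * e)) = 0 := by
        rw [← Nat.cast_mul, ZMod.natCast_self]
      simp only [smul_eq_mul]
      push_cast
      linear_combination (a * e * q + a * ((x ⬝ᵥ k : ℤ) : ZMod (level Q * e))) * h6
    have h3 : ZMod.stdAddChar (N := level Q * e)
        ((e * (n ⬝ᵥ B *ᵥ k) : ℤ) : ZMod (level Q * e)) = 1 := by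
      refine mul_right_cancel₀ h ?_
      rw [one_mul]; exact h2.symm
    rw [← AddChar.map_zero_eq_one (ZMod.stdAddChar (N := level Q * e))] at h3
    have h4 := (ZMod.intCast_zmod_eq_zero_iff_dvd _ _).1 (ZMod.injective_stdAddChar h3)
    rw [Nat.cast_mul, mul_comm] at h4
    exact Int.dvd_of_mul_dvd_mul_left he0 h4
  -- hence `B n` is divisible by the level `N`, and `A (B n / N) = n`
  have h2 : ∀ i, ∃ t, (B *ᵥ n) i = level Q * t := fun i => by
    have h3 := h1 (Pi.single i 1)
    rw [dotProduct_mulVec, dotProduct_single, mul_one, ← mulVec_transpose, hs] at h3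
    exact h3
  choose m hm using h2
  refine ⟨m, smul_right_injective _ hN ?_⟩
  have h3 : B *ᵥ n = (level Q : ℤ) • m := by ext i; simp [hm]
  simp only
  rw [← mulVec_smul, ← h3, mulVec_mulVec, hB, smul_mulVec, one_mulVec]

end expSum

end QuadTheta

/-! ### Modularity up to a multiplier -/

namespace QuadTheta
open Matrix

variable {r : ℕ} {Q : QuadraticForm ℤ (Fin (2 * r) → ℤ)}

/-- `Q` transforms under `γ` with multiplier `C`: the Jacobi theta series of `Q` has the
transformation behaviour of a Jacobi form of weight `r` under `γ`, up to the factor `C`. With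
`u = A z`, the quantity `uᵗ A⁻¹ u` in the exponential is `⟨z, z⟩`. -/
def Transforms (Q : QuadraticForm ℤ (Fin (2 * r) → ℤ)) (γ : SL(2, ℤ)) (C : ℂ) : Prop :=
  ∀ (τ : UpperHalfPlane) (u : Fin (2 * r) → ℂ),
    jtheta Q ((γ • τ : UpperHalfPlane) : ℂ) (((γ 1 0 : ℂ) * τ + γ 1 1)⁻¹ • u) =
      C * ((γ 1 0 : ℂ) * τ + γ 1 1) ^ r *
        Complex.exp (Real.pi * Complex.I * γ 1 0 * cbil (gramR Q)⁻¹ u u /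
          ((γ 1 0 : ℂ) * τ + γ 1 1)) * jtheta Q τ u

lemma coe_smul_eq (γ : SL(2, ℤ)) (τ : UpperHalfPlane) :
    ((γ • τ : UpperHalfPlane) : ℂ) =
      ((γ 0 0 : ℂ) * τ + γ 0 1) / ((γ 1 0 : ℂ) * τ + γ 1 1) := by
  rw [UpperHalfPlane.coe_specialLinearGroup_apply]; simp

lemma det_eq_one (γ : SL(2, ℤ)) : γ 0 0 * γ 1 1 - γ 0 1 * γ 1 0 = 1 := by
  have := γ.det_coe; rwa [Matrix.det_fin_two] at this

lemma mul_entry (γ γ' : SL(2, ℤ)) (i j : Fin 2) :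
    (γ * γ') i j = γ i 0 * γ' 0 j + γ i 1 * γ' 1 j := by
  have := congrFun (congrFun (Matrix.SpecialLinearGroup.coe_mul γ γ') i) j
  rwa [Matrix.mul_apply, Fin.sum_univ_two] at this

lemma automorphy_ne_zero (γ : SL(2, ℤ)) (τ : UpperHalfPlane) :
    (γ 1 0 : ℂ) * τ + γ 1 1 ≠ 0 := by
  intro h
  have h1 := congrArg Complex.im h
  simp only [Complex.add_im, Complex.mul_im, Complex.intCast_re, Complex.intCast_im, zero_mul,
    add_zero, Complex.zero_im, UpperHalfPlane.coe_im] at h1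
  have h2 : γ 1 0 = 0 := by
    rcases mul_eq_zero.1 h1 with h2 | h2
    · exact_mod_cast h2
    · exact absurd h2 τ.im_pos.ne'
  have h3 : γ 1 1 = 0 := by rw [h2] at h; simpa using h
  have := det_eq_one γ
  rw [h2, h3] at this; simp at this

section cbilInv

variable {f : ℕ} {Q : QuadraticForm ℤ (Fin f → ℤ)}

/-- Inserting `u` and `A m` into the form of `A⁻¹` gives the dot product `u · m`. -/
lemma cbil_inv_mulVec (hQ : Q.PosDef) (u : Fin f → ℂ) (m : Fin f → ℂ) :
    cbil (gramR Q)⁻¹ u ((gramR Q).map (algebraMap ℝ ℂ) *ᵥ m) = ∑ i, u i * m i := by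
  rw [cbil, mulVec_mulVec, ← Matrix.map_mul,
    nonsing_inv_mul _ (posDef_gramR hQ).det_pos.ne'.isUnit]
  simp [dotProduct]

lemma mulVec_intCast (m : Fin f → ℤ) :
    (fun i => (((gram Q *ᵥ m) i : ℤ) : ℂ)) =
      (gramR Q).map (algebraMap ℝ ℂ) *ᵥ fun i => (m i : ℂ) := by
  ext i; simp [gramR, mulVec, dotProduct]

lemma mulVec_gram_injective (hQ : Q.PosDef) : Function.Injective fun m => gram Q *ᵥ m :=
  Matrix.mulVec_injective_of_det_ne_zero (det_gram_ne_zero hQ)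

end cbilInv

lemma exists_transforms_of_pos (hQ : Q.PosDef) {γ : SL(2, ℤ)}
    (hγ : (level Q : ℤ) ∣ γ 1 0) (hpos : 0 < γ 1 0) : ∃ C, Transforms Q γ C := by
  obtain ⟨c, hc⟩ := Int.eq_ofNat_of_zero_le hpos.le
  have : NeZero c := ⟨by rintro rfl; simp [hc] at hpos⟩
  have hc0 : (c : ℂ) ≠ 0 := by exact_mod_cast NeZero.ne c
  refine ⟨((√(gramR Q).det : ℝ) : ℂ)⁻¹ * ((c * Complex.I) ^ r)⁻¹ * expSum Q (γ 0 0) c 0,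
    fun τ u => ?_⟩
  have hdet := det_eq_one γ
  rw [hc] at hdet hγ
  have hγ' : level Q ∣ c := by exact_mod_cast hγ
  have hinv := jtheta_inversion hQ (c := c) hdet τ.im_pos u
  have hcast : ((γ 1 0 : ℤ) : ℂ) = c := by rw [hc]; simp
  rw [coe_smul_eq, hcast]
  rw [hinv]
  have had : ((γ 0 0 * γ 1 1 : ℤ) : ZMod c) = 1 := by
    have h1 := congrArg (Int.cast : ℤ → ZMod c) hdet
    push_cast at h1 ⊢
    simpa using h1
  -- only the vectors `A m` contribute
  have hsum : ∑' n : Fin (2 * r) → ℤ, Complex.exp (Real.pi * Complex.I *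
        ((τ + γ 1 1 / c) * cbil (gramR Q)⁻¹ (fun i => (n i : ℂ)) (fun i => (n i : ℂ)) -
          2 * cbil (gramR Q)⁻¹ u (fun i => (n i : ℂ)))) * expSum Q (γ 0 0) c n =
      expSum Q (γ 0 0) c 0 * jtheta Q τ u := by
    rw [← (mulVec_gram_injective hQ).tsum_eq, ← jtheta_neg, jtheta, ← tsum_mul_left]
    · refine tsum_congr fun m => ?_
      rw [expSum_mulVec had, mulVec_intCast, cbil_inv_mulVec hQ, cbil_inv_mulVec hQ, jterm]
      have h1 : ∑ i, ((gramR Q).map (algebraMap ℝ ℂ) *ᵥ fun i => (m i : ℂ)) i * (m i : ℂ) =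
          2 * Q m := by
        rw [← mulVec_intCast]
        have h2 := two_mul_apply Q m
        rw [dotProduct_comm] at h2
        have h3 := congrArg (Int.cast : ℤ → ℂ) h2
        simp only [dotProduct] at h3
        push_cast at h3
        rw [h3]
      rw [h1, ZMod.stdAddChar_coe, ← mul_assoc, ← Complex.exp_add, mul_comm]
      congr 2
      simp only [Pi.neg_apply, neg_mul, Finset.sum_neg_distrib]
      push_cast
      field_simp
      ring
    · intro n hn
      exact exists_mulVec_eq_of_expSum_ne_zero hQ hγ' (right_ne_zero_of_mul hn)
  rw [hsum, div_pow]
  ring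

lemma Transforms.of_neg {γ : SL(2, ℤ)} {C : ℂ} (h : Transforms Q (-γ) C) :
    Transforms Q γ ((-1) ^ r * C) := by
  intro τ u
  have h1 := h τ u
  have hs : (-γ) • τ = γ • τ := by
    ext; rw [coe_smul_eq, coe_smul_eq]
    simp only [Matrix.SpecialLinearGroup.coe_neg, Matrix.neg_apply, Int.cast_neg]
    rw [← neg_div_neg_eq]; congr 1 <;> ring
  have hT : (((-γ) 1 0 : ℤ) : ℂ) * τ + ((-γ) 1 1 : ℤ) = -((γ 1 0 : ℂ) * τ + γ 1 1) := by
    simp only [Matrix.SpecialLinearGroup.coe_neg, Matrix.neg_apply, Int.cast_neg]; ring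
  rw [hT, hs, inv_neg, neg_smul, jtheta_neg] at h1
  rw [h1, neg_pow]
  simp only [Matrix.SpecialLinearGroup.coe_neg, Matrix.neg_apply, Int.cast_neg, mul_neg, neg_mul,
    neg_div_neg_eq]
  ring

lemma transforms_of_eq_zero {γ : SL(2, ℤ)} (hc : γ 1 0 = 0) (hd : γ 1 1 = 1) :
    Transforms Q γ 1 := by
  intro τ u
  have ha : γ 0 0 = 1 := by have := det_eq_one γ; rw [hc, hd] at this; linarith
  rw [coe_smul_eq, hc, hd, ha]
  simpa using jtheta_add_intCast Q τ (γ 0 1) u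

/-- The theta series of `Q` is modular up to a constant for `Γ₀(N)`, `N` the level of `Q`. -/
theorem exists_transforms (hQ : Q.PosDef) {γ : SL(2, ℤ)}
    (hγ : γ ∈ CongruenceSubgroup.Gamma0 (level Q)) : ∃ C, Transforms Q γ C := by
  have hdvd : (level Q : ℤ) ∣ γ 1 0 :=
    (ZMod.intCast_zmod_eq_zero_iff_dvd _ _).1 (CongruenceSubgroup.Gamma0_mem.1 hγ)
  rcases lt_trichotomy (γ 1 0) 0 with h | h | h
  · obtain ⟨C, hC⟩ := exists_transforms_of_pos hQ (γ := -γ) (by simpa using hdvd) (by simpa using h)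
    exact ⟨_, hC.of_neg⟩
  · have hdet := det_eq_one γ
    rw [h, mul_zero, sub_zero] at hdet
    rcases Int.eq_one_or_neg_one_of_mul_eq_one (mul_comm (γ 0 0) _ ▸ hdet) with hd | hd
    · exact ⟨1, transforms_of_eq_zero h hd⟩
    · exact ⟨_, (transforms_of_eq_zero (γ := -γ) (by simpa using h) (by simp [hd])).of_neg⟩
  · exact exists_transforms_of_pos hQ hdvd h

lemma Transforms.jtheta_zero {γ : SL(2, ℤ)} {C : ℂ} (h : Transforms Q γ C) (τ : UpperHalfPlane) :
    jtheta Q ((γ • τ : UpperHalfPlane) : ℂ) 0 =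
      C * ((γ 1 0 : ℂ) * τ + γ 1 1) ^ r * jtheta Q τ 0 := by
  simpa [cbil] using h τ 0

/-- The point `i t` of the upper half-plane. -/
def imAxis (t : ℝ) (ht : 0 < t) : UpperHalfPlane := ⟨Complex.I * t, by simpa using ht⟩

/-- The theta series tends to one as `τ → i ∞`. -/
lemma exists_jtheta_ne_zero (hQ : Q.PosDef) : ∃ τ : UpperHalfPlane, jtheta Q τ 0 ≠ 0 := by
  have h := tendsto_tsum_mul_exp_neg (posDef_gramR hQ) (fun _ => 1) (K := 1) (by simp)
  obtain ⟨t, ht, h1⟩ := ((h.eventually_ne one_ne_zero).and (Filter.eventually_gt_atTop 0)).exists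
  refine ⟨imAxis t h1, ?_⟩
  rw [jtheta]
  convert ht using 3 with m
  have h2 : cbil (gramR Q) (fun i => (m i : ℂ)) (fun i => (m i : ℂ)) = 2 * Q m := by
    have h3 := cbil_ofReal (gramR Q) (fun i => (m i : ℝ)) (fun i => (m i : ℝ))
    rw [gramR_intCast, ← two_mul_apply] at h3
    simpa using h3
  rw [h2, jterm, one_mul]
  congr 1
  simp only [imAxis, Pi.zero_apply, zero_mul, Finset.sum_const_zero, add_zero]
  linear_combination (2 * Real.pi * Q m * t : ℂ) * Complex.I_sq

lemma Transforms.unique (hQ : Q.PosDef) {γ : SL(2, ℤ)} {C C' : ℂ} (h : Transforms Q γ C)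
    (h' : Transforms Q γ C') : C = C' := by
  obtain ⟨τ, hτ⟩ := exists_jtheta_ne_zero hQ
  have h1 := (h.jtheta_zero τ).symm.trans (h'.jtheta_zero τ)
  exact mul_right_cancel₀ (pow_ne_zero r (automorphy_ne_zero γ τ)) (mul_right_cancel₀ hτ h1)

lemma Transforms.mul_eq (hQ : Q.PosDef) {γ γ' : SL(2, ℤ)} {C C' C'' : ℂ} (h : Transforms Q γ C)
    (h' : Transforms Q γ' C') (h'' : Transforms Q (γ * γ') C'') : C'' = C * C' := by
  obtain ⟨τ, hτ⟩ := exists_jtheta_ne_zero hQ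
  have h1 := h.jtheta_zero (γ' • τ)
  rw [← mul_smul, h''.jtheta_zero τ, h'.jtheta_zero τ] at h1
  have hne := automorphy_ne_zero γ' τ
  have hcoc : (((γ * γ') 1 0 : ℤ) : ℂ) * τ + ((γ * γ') 1 1 : ℤ) =
      ((γ 1 0 : ℂ) * ((γ' • τ : UpperHalfPlane) : ℂ) + γ 1 1) * ((γ' 1 0 : ℂ) * τ + γ' 1 1) := by
    rw [coe_smul_eq]
    rw [mul_entry, mul_entry]
    push_cast
    field_simp
    ring
  rw [hcoc, mul_pow] at h1
  refine mul_right_cancel₀ (mul_ne_zero (mul_ne_zero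
    (pow_ne_zero r (automorphy_ne_zero γ (γ' • τ))) (pow_ne_zero r hne)) hτ) ?_
  linear_combination h1

lemma norm_expSum_le (a : ℤ) (c : ℕ) [NeZero c] (n : Fin (2 * r) → ℤ) :
    ‖expSum Q a c n‖ ≤ Fintype.card (Fin (2 * r) → ZMod c) := by
  refine (norm_sum_le _ _).trans ?_
  simp only [ZMod.stdAddChar_apply, Circle.norm_coe]
  simp

/-- Comparing the behaviour of both sides of the transformation law as `τ → 0` along the
imaginary axis evaluates the multiplier by an exponential sum modulo `d`. -/
theorem Transforms.eq_expSum (hQ : Q.PosDef) {γ : SL(2, ℤ)} {C : ℂ} (h : Transforms Q γ C)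
    {d : ℕ} [NeZero d] (hd : γ 1 1 = d) : C = ((d : ℂ) ^ r)⁻¹ * expSum Q (γ 0 1) d 0 := by
  have hd0 : (d : ℂ) ≠ 0 := by exact_mod_cast NeZero.ne d
  have hT := (posDef_gramR hQ).inv
  have hq : ∀ n : Fin (2 * r) → ℤ, cbil (gramR Q)⁻¹ (fun i => (n i : ℂ)) (fun i => (n i : ℂ)) =
      (((fun i => (n i : ℝ)) ⬝ᵥ (gramR Q)⁻¹ *ᵥ fun i => (n i : ℝ) : ℝ) : ℂ) := by
    intro n; rw [← cbil_ofReal]; simp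
  set w : (Fin (2 * r) → ℤ) → ℂ := fun n => Complex.exp (Real.pi * Complex.I *
    (-(γ 1 0 : ℂ) / d * cbil (gramR Q)⁻¹ (fun i => (n i : ℂ)) (fun i => (n i : ℂ)))) *
      expSum Q (γ 0 1) d n with hw
  have hwn : ∀ n, ‖w n‖ ≤ Fintype.card (Fin (2 * r) → ZMod d) := by
    intro n
    have h1 : Real.pi * Complex.I * (-(γ 1 0 : ℂ) / d *
        cbil (gramR Q)⁻¹ (fun i => (n i : ℂ)) (fun i => (n i : ℂ))) =
        ((Real.pi * (-(γ 1 0 : ℝ) / d *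
          ((fun i => (n i : ℝ)) ⬝ᵥ (gramR Q)⁻¹ *ᵥ fun i => (n i : ℝ))) : ℝ) : ℂ) * Complex.I := by
      rw [hq]; push_cast; ring
    simp only [hw]
    rw [norm_mul, h1, Complex.norm_exp_ofReal_mul_I, one_mul]
    exact norm_expSum_le _ _ _
  have hl1 := tendsto_tsum_mul_exp_neg hT w hwn
  have hl2 := tendsto_tsum_mul_exp_neg hT (fun _ => 1) (K := 1) (by simp)
  have hw0 : w 0 = expSum Q (γ 0 1) d 0 := by simp [hw, cbil, ← Pi.zero_def]
  rw [hw0] at hl1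
  have hl1' := hl1.const_mul ((d : ℂ) ^ r)⁻¹
  have hl2' := hl2.const_mul C
  rw [mul_one] at hl2'
  refine tendsto_nhds_unique (hl2'.congr' ?_) hl1'
  filter_upwards [Filter.eventually_gt_atTop 0] with t ht
  set τ := imAxis t ht with hτ
  have hτc : (τ : ℂ) = Complex.I * t := rfl
  have hτ0 : (τ : ℂ) ≠ 0 := τ.ne_zero
  have hτim : 0 < (τ : ℂ).im := τ.im_pos
  have hdet := det_eq_one γ
  -- write `τ → 0` as `S τ` with `τ = i t → i ∞`, and apply inversion to both `γ S` and `S`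
  have e1 := jtheta_inversion hQ (a := γ 0 1) (b := -γ 0 0) (c := d) (d := -γ 1 0)
    (by rw [← hd]; linarith) hτim 0
  have e2 := jtheta_inversion hQ (a := 0) (b := -1) (c := 1) (d := 0) (by simp) hτim 0
  have hS : (((ModularGroup.S • τ : UpperHalfPlane)) : ℂ) = -1 / τ := by
    rw [coe_smul_eq]; simp [ModularGroup.coe_S]
  have e3 := h.jtheta_zero (ModularGroup.S • τ)
  rw [coe_smul_eq, hS, hd] at e3
  have hD : (d : ℂ) * τ - γ 1 0 ≠ 0 := by
    have := automorphy_ne_zero (γ * ModularGroup.S) τ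
    simpa [ModularGroup.coe_S, Matrix.mul_apply, Fin.sum_univ_two, hd, sub_eq_add_neg] using this
  have hfrac : ((γ 0 0 : ℂ) * (-1 / τ) + γ 0 1) / ((γ 1 0 : ℂ) * (-1 / τ) + ((d : ℤ) : ℂ)) =
      ((γ 0 1 : ℂ) * τ + ((-γ 0 0 : ℤ) : ℂ)) / (d * τ + ((-γ 1 0 : ℤ) : ℂ)) := by
    have h1 : (γ 1 0 : ℂ) * (-1 / τ) + ((d : ℤ) : ℂ) = (d * τ + ((-γ 1 0 : ℤ) : ℂ)) / τ := by
      push_cast; field_simp; ring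
    rw [h1]; push_cast; field_simp; ring
  rw [hfrac] at e3
  rw [smul_zero, e3] at e1
  have e2' : jtheta Q (-1 / τ) 0 = ((√(gramR Q).det : ℝ) : ℂ)⁻¹ * (τ / Complex.I) ^ r *
      ∑' n : Fin (2 * r) → ℤ, Complex.exp (Real.pi * Complex.I *
        (τ * cbil (gramR Q)⁻¹ (fun i => (n i : ℂ)) (fun i => (n i : ℂ)))) := by
    have h1 : ∀ n : Fin (2 * r) → ℤ, expSum Q 0 1 n = 1 := fun n => by
      rw [expSum, Fintype.sum_unique, Subsingleton.elim (Int.cast _ : ZMod 1) 0,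
        AddChar.map_zero_eq_one]
    simpa [cbil, h1] using e2
  rw [e2'] at e1
  have hE : ∀ n : Fin (2 * r) → ℤ, Complex.exp (Real.pi * Complex.I *
        (τ * cbil (gramR Q)⁻¹ (fun i => (n i : ℂ)) (fun i => (n i : ℂ)))) =
      1 * Complex.exp (-(Real.pi * t) *
        cbil (gramR Q)⁻¹ (fun i => (n i : ℂ)) (fun i => (n i : ℂ))) := by
    intro n
    rw [one_mul, hτc]; congr 1
    linear_combination (Real.pi * t *
      cbil (gramR Q)⁻¹ (fun i => (n i : ℂ)) (fun i => (n i : ℂ)) : ℂ) * Complex.I_sq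
  have hF : ∀ n : Fin (2 * r) → ℤ, Complex.exp (Real.pi * Complex.I *
        ((τ + ((-γ 1 0 : ℤ) : ℂ) / d) *
          cbil (gramR Q)⁻¹ (fun i => (n i : ℂ)) (fun i => (n i : ℂ)) -
          2 * cbil (gramR Q)⁻¹ 0 (fun i => (n i : ℂ)))) * expSum Q (γ 0 1) d n =
      w n * Complex.exp (-(Real.pi * t) *
        cbil (gramR Q)⁻¹ (fun i => (n i : ℂ)) (fun i => (n i : ℂ))) := by
    intro n
    have h0 : cbil (gramR Q)⁻¹ 0 (fun i => (n i : ℂ)) = 0 := by simp [cbil]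
    simp only [hw]
    rw [mul_right_comm (Complex.exp _) _ (Complex.exp _), ← Complex.exp_add, hτc, h0]
    congr 2
    push_cast
    linear_combination (Real.pi * t *
      cbil (gramR Q)⁻¹ (fun i => (n i : ℂ)) (fun i => (n i : ℂ)) : ℂ) * Complex.I_sq
  simp only [hE, hF] at e1
  have hdetpos := (posDef_gramR hQ).det_pos
  have hs0 : ((√(gramR Q).det : ℝ) : ℂ) ≠ 0 := by
    exact_mod_cast (Real.sqrt_pos.2 hdetpos).ne'
  have hexp0 : Complex.exp (Real.pi * Complex.I * d * cbil (gramR Q)⁻¹ 0 0 /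
      (d * τ + ((-γ 1 0 : ℤ) : ℂ))) = 1 := by simp [cbil]
  rw [hexp0, mul_one] at e1
  have hpw : ((γ 1 0 : ℂ) * (-1 / τ) + ((d : ℤ) : ℂ)) ^ r * (τ / Complex.I) ^ r =
      (d : ℂ) ^ r * ((d * τ + ((-γ 1 0 : ℤ) : ℂ)) / (d * Complex.I)) ^ r := by
    rw [← mul_pow, ← mul_pow]; congr 1
    push_cast
    have := Complex.I_ne_zero
    field_simp
    ring
  have hne : ((d * (τ : ℂ) + ((-γ 1 0 : ℤ) : ℂ)) / (d * Complex.I)) ^ r ≠ 0 := by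
    refine pow_ne_zero _ (div_ne_zero ?_ (mul_ne_zero hd0 Complex.I_ne_zero))
    push_cast; rwa [← sub_eq_add_neg]
  rw [eq_inv_mul_iff_mul_eq₀ (pow_ne_zero r hd0)]
  refine mul_left_cancel₀ (mul_ne_zero (inv_ne_zero hs0) hne) ?_
  rw [← e1]
  linear_combination (-C * ((√(gramR Q).det : ℝ) : ℂ)⁻¹ * ∑' n : Fin (2 * r) → ℤ,
    1 * Complex.exp (-(Real.pi * t) *
      cbil (gramR Q)⁻¹ (fun i => (n i : ℂ)) (fun i => (n i : ℂ)))) * hpw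

end QuadTheta

/-! ### Quadratic Gauss sums over finite fields -/

namespace QuadTheta
open Matrix

section finiteField

variable {K : Type} [Field K] [Fintype K] [DecidableEq K]

/-- The quadratic character of a finite field, with values in `ℂ`. -/
noncomputable def quadCharC (K : Type) [Field K] [Fintype K] [DecidableEq K] : MulChar K ℂ :=
  (quadraticChar K).ringHomComp (Int.castRingHom ℂ)

lemma quadCharC_apply (a : K) : quadCharC K a = (quadraticChar K a : ℂ) := rfl

lemma quadCharC_isQuadratic : (quadCharC K).IsQuadratic :=
  (quadraticChar_isQuadratic K).comp _

lemma quadCharC_ne_one (hK : ringChar K ≠ 2) : quadCharC K ≠ 1 :=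
  (MulChar.ringHomComp_ne_one_iff (Int.castRingHom ℂ).injective_int).2 (quadraticChar_ne_one hK)

lemma quadCharC_sq_eq_one {a : K} (ha : a ≠ 0) : quadCharC K a ^ 2 = 1 := by
  rw [quadCharC_apply]; exact_mod_cast quadraticChar_sq_one ha

/-- One-variable quadratic Gauss sums. -/
lemma sum_addChar_mul_sq (hK : ringChar K ≠ 2) {ψ : AddChar K ℂ} (hψ : ψ.IsPrimitive) {a : K}
    (ha : a ≠ 0) : ∑ x : K, ψ (a * x ^ 2) = quadCharC K a * gaussSum (quadCharC K) ψ := by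
  -- the number of square roots of `y` is `χ(y) + 1`
  have h1 : ∑ x : K, ψ (a * x ^ 2) = ∑ y : K, (quadCharC K y + 1) * ψ (a * y) := by
    rw [← Finset.sum_fiberwise (s := Finset.univ) (g := fun x : K => x ^ 2)]
    refine Finset.sum_congr rfl fun y _ => ?_
    rw [Finset.sum_congr rfl fun x hx => by rw [(Finset.mem_filter.1 hx).2], Finset.sum_const,
      nsmul_eq_mul]
    congr 1
    have h2 := quadraticChar_card_sqrts hK y
    rw [quadCharC_apply]
    have h3 : (({x : K | x ^ 2 = y}.toFinset.card : ℤ) : ℂ) = (quadraticChar K y : ℂ) + 1 := by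
      rw [h2]; push_cast; rfl
    rw [← h3]
    simp
  have h2 : ∑ y : K, ψ (a * y) = 0 := by
    have := AddChar.sum_mulShift a hψ
    simp only [mul_comm _ a, ha, if_false] at this
    simpa using this
  have h3 := gaussSum_mulShift (quadCharC K) ψ (Units.mk0 a ha)
  simp only [Units.val_mk0] at h3
  rw [h1]
  simp only [add_mul, one_mul, Finset.sum_add_distrib, h2, add_zero]
  have h4 : gaussSum (quadCharC K) (ψ.mulShift a) = ∑ y : K, quadCharC K y * ψ (a * y) := rfl
  rw [← h4, ← h3, ← mul_assoc, ← pow_two, quadCharC_sq_eq_one ha, one_mul]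

/-- Symmetric matrices over a field of odd characteristic are congruent to diagonal ones. -/
lemma exists_diagonal_congr {F : Type*} [Field F] (h2 : (2 : F) ≠ 0) {f : ℕ}
    {M : Matrix (Fin f) (Fin f) F} (hM : Mᵀ = M) :
    ∃ (P : Matrix (Fin f) (Fin f) F) (w : Fin f → F), P.det ≠ 0 ∧ Pᵀ * M * P = diagonal w := by
  have : Invertible (2 : F) := invertibleOfNonzero h2
  have hs : LinearMap.IsSymm (Matrix.toBilin' M) := by
    refine ⟨fun x y => ?_⟩
    change Matrix.toBilin' M x y = Matrix.toBilin' M y x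
    rw [Matrix.toBilin'_apply', Matrix.toBilin'_apply']
    rw [dotProduct_comm, ← vecMul_transpose, hM, ← dotProduct_mulVec]
  obtain ⟨v, hv⟩ := LinearMap.BilinForm.exists_orthogonal_basis hs
  set e : Fin (Module.finrank F (Fin f → F)) ≃ Fin f := finCongr (by simp)
  set v' := v.reindex e with hv'
  set P : Matrix (Fin f) (Fin f) F := (Pi.basisFun F (Fin f)).toMatrix v' with hP
  have hPij : ∀ i j, P i j = v' j i := fun i j => by simp [hP, Module.Basis.toMatrix_apply]
  refine ⟨P, fun i => (Pᵀ * M * P) i i, ?_, ?_⟩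
  · have := (Pi.basisFun F (Fin f)).toMatrix_mul_toMatrix_flip v'
    have h3 := congrArg det this
    rw [det_mul, det_one] at h3
    exact left_ne_zero_of_mul (h3.symm ▸ one_ne_zero)
  · ext i j
    rw [diagonal_apply]
    split_ifs with hij
    · rw [hij]
    · have h3 : (Pᵀ * M * P) i j = v' i ⬝ᵥ M *ᵥ v' j := by
        rw [Matrix.mul_assoc]
        simp only [Matrix.mul_apply, transpose_apply, hPij, dotProduct, mulVec]
      rw [h3, ← Matrix.toBilin'_apply']
      have h4 := LinearMap.isOrthoᵢ_def.1 hv (e.symm i) (e.symm j)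
        (fun h => hij (e.symm.injective h))
      simpa [hv'] using h4

/-- Quadratic Gauss sums in an even number of variables over a finite field. -/
theorem sum_addChar_quadratic (hK : ringChar K ≠ 2) {ψ : AddChar K ℂ} (hψ : ψ.IsPrimitive)
    {r : ℕ} {M : Matrix (Fin (2 * r)) (Fin (2 * r)) K} (hM : Mᵀ = M) (hdet : M.det ≠ 0) {a : K}
    (ha : a ≠ 0) : ∑ g : Fin (2 * r) → K, ψ (a * (g ⬝ᵥ M *ᵥ g)) =
      quadCharC K ((-1) ^ r * M.det) * Fintype.card K ^ r := by
  obtain ⟨P, w, hP, hw⟩ := exists_diagonal_congr (Ring.two_ne_zero hK) hM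
  have hdetw : ∏ i, w i = P.det ^ 2 * M.det := by
    rw [← det_diagonal, ← hw, det_mul, det_mul, det_transpose]; ring
  have hw0 : ∀ i, w i ≠ 0 := by
    have : ∏ i, w i ≠ 0 := by rw [hdetw]; exact mul_ne_zero (pow_ne_zero 2 hP) hdet
    exact fun i => Finset.prod_ne_zero_iff.1 this i (Finset.mem_univ i)
  have hbij : Function.Bijective fun g : Fin (2 * r) → K => P *ᵥ g :=
    Finite.injective_iff_bijective.1 (Matrix.mulVec_injective_of_det_ne_zero hP)
  have h1 : ∀ g : Fin (2 * r) → K, (P *ᵥ g) ⬝ᵥ M *ᵥ (P *ᵥ g) = ∑ i, w i * g i ^ 2 := by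
    intro g
    rw [← vecMul_transpose P g, ← dotProduct_mulVec, vecMul_transpose, mulVec_mulVec,
      mulVec_mulVec, hw]
    simp only [dotProduct, mulVec_diagonal]
    exact Finset.sum_congr rfl fun i _ => by ring
  calc ∑ g : Fin (2 * r) → K, ψ (a * (g ⬝ᵥ M *ᵥ g))
      = ∑ g : Fin (2 * r) → K, ∏ i, ψ (a * w i * g i ^ 2) := by
        rw [← hbij.sum_comp]
        refine Finset.sum_congr rfl fun g _ => ?_
        simp only [h1, Finset.mul_sum, mul_assoc]
        exact map_prod ψ.toMonoidHom (fun i => Multiplicative.ofAdd _) Finset.univ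
    _ = ∏ i, ∑ x : K, ψ (a * w i * x ^ 2) := by
        rw [Finset.prod_univ_sum, Fintype.piFinset_univ]
    _ = ∏ i, quadCharC K (a * w i) * gaussSum (quadCharC K) ψ :=
        Finset.prod_congr rfl fun i _ => sum_addChar_mul_sq hK hψ (mul_ne_zero ha (hw0 i))
    _ = (quadCharC K a ^ 2) ^ r * (quadCharC K P.det ^ 2 * quadCharC K M.det) *
          (gaussSum (quadCharC K) ψ ^ 2) ^ r := by
        rw [Finset.prod_mul_distrib, ← map_prod, Finset.prod_mul_distrib, hdetw]
        simp [map_mul, map_pow, pow_mul]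
    _ = _ := by
        rw [quadCharC_sq_eq_one ha, quadCharC_sq_eq_one hP,
          gaussSum_sq (quadCharC_ne_one hK) quadCharC_isQuadratic hψ, map_mul, map_pow, mul_pow]
        ring

end finiteField

/-- The exponential sums modulo an odd prime not dividing the determinant. -/
theorem expSum_prime {r : ℕ} (Q : QuadraticForm ℤ (Fin (2 * r) → ℤ)) {p : ℕ} [NeZero p]
    (hp : p.Prime) (hp2 : p ≠ 2) {b : ℤ} (hb : ¬ (p : ℤ) ∣ b) (hdet : ¬ (p : ℤ) ∣ (gram Q).det) :
    expSum Q b p 0 = (jacobiSym ((-1) ^ r * (gram Q).det) p : ℂ) * p ^ r := by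
  have : Fact p.Prime := ⟨hp⟩
  have hchar : ringChar (ZMod p) ≠ 2 := by rwa [ZMod.ringChar_zmod_n]
  have h2 : (2 : ZMod p) ≠ 0 := Ring.two_ne_zero hchar
  set M : Matrix (Fin (2 * r)) (Fin (2 * r)) (ZMod p) := (gram Q).map (Int.cast : ℤ → ZMod p)
    with hM
  have hMs : Mᵀ = M := by rw [hM, ← transpose_map, gram_transpose]
  have hMd : M.det = ((gram Q).det : ZMod p) :=
    ((Int.castRingHom (ZMod p)).map_det (gram Q)).symm
  have hMd0 : M.det ≠ 0 := by
    rw [hMd, Ne, ZMod.intCast_zmod_eq_zero_iff_dvd]; exact hdet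
  have hb0 : (b : ZMod p) / 2 ≠ 0 := by
    refine div_ne_zero ?_ h2
    rw [Ne, ZMod.intCast_zmod_eq_zero_iff_dvd]; exact hb
  have h := sum_addChar_quadratic hchar (ZMod.isPrimitive_stdAddChar p) hMs hMd0 hb0
  rw [ZMod.card] at h
  rw [← jacobiSym.legendreSym.to_jacobiSym, legendreSym]
  rw [quadCharC_apply, hMd] at h
  have hcast : (((-1) ^ r * (gram Q).det : ℤ) : ZMod p) = (-1) ^ r * ((gram Q).det : ZMod p) := by
    rw [Int.cast_mul, Int.cast_pow, Int.cast_neg, Int.cast_one]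
  rw [hcast, ← h, expSum]
  refine Finset.sum_congr rfl fun g _ => ?_
  congr 1
  have h3 := congrArg (Int.cast : ℤ → ZMod p) (two_mul_apply Q fun i => ((g i).val : ℤ))
  have h4 : ((fun i => ((g i).val : ℤ)) ⬝ᵥ gram Q *ᵥ (fun i => ((g i).val : ℤ)) : ℤ) =
      (g ⬝ᵥ M *ᵥ g : ZMod p) := by
    simp only [dotProduct, mulVec, hM, Matrix.map_apply]
    push_cast
    simp
  rw [h4] at h3
  rw [← h3, zero_dotProduct]
  push_cast
  field_simp
  ring

end QuadTheta

/-! ### The multiplier is a Dirichlet character -/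

namespace QuadTheta
open Matrix

variable {r : ℕ} {Q : QuadraticForm ℤ (Fin (2 * r) → ℤ)}

lemma isCoprime_row (γ : SL(2, ℤ)) : IsCoprime (γ 1 0) (γ 1 1) :=
  ⟨-γ 0 1, γ 0 0, by linarith [det_eq_one γ]⟩

lemma mem_Gamma0_iff_dvd {N : ℕ} {γ : SL(2, ℤ)} :
    γ ∈ CongruenceSubgroup.Gamma0 N ↔ (N : ℤ) ∣ γ 1 0 := by
  rw [CongruenceSubgroup.Gamma0_mem, ZMod.intCast_zmod_eq_zero_iff_dvd]

/-- The multiplier is trivial if the lower right entry is one. -/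
lemma Transforms.eq_one (hQ : Q.PosDef) {γ : SL(2, ℤ)} {C : ℂ} (h : Transforms Q γ C)
    (hd : γ 1 1 = 1) : C = 1 := by
  rw [h.eq_expSum hQ (d := 1) (by simpa using hd), expSum, Fintype.sum_unique,
    Subsingleton.elim (Int.cast _ : ZMod 1) 0, AddChar.map_zero_eq_one]
  simp

/-- Multiplying on the right by a matrix in `Γ₀(N)` with lower right entry one does not change
the multiplier. -/
lemma Transforms.mul_right (hQ : Q.PosDef) {γ γ' : SL(2, ℤ)} {C : ℂ} (h : Transforms Q γ C)
    (hγ : γ ∈ CongruenceSubgroup.Gamma0 (level Q))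
    (hγ' : γ' ∈ CongruenceSubgroup.Gamma0 (level Q)) (hd : γ' 1 1 = 1) :
    Transforms Q (γ * γ') C := by
  obtain ⟨C', h'⟩ := exists_transforms hQ hγ'
  obtain ⟨C'', h''⟩ := exists_transforms hQ (mul_mem hγ hγ')
  have := h.mul_eq hQ h' h''
  rwa [this, h'.eq_one hQ hd, mul_one] at h''

lemma T_zpow_mem_Gamma0 (N : ℕ) (k : ℤ) :
    ModularGroup.T ^ k ∈ CongruenceSubgroup.Gamma0 N := by
  rw [mem_Gamma0_iff_dvd, ModularGroup.coe_T_zpow]; simp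

lemma mul_T_zpow_row (γ : SL(2, ℤ)) (k : ℤ) :
    (γ * ModularGroup.T ^ k) 1 0 = γ 1 0 ∧ (γ * ModularGroup.T ^ k) 1 1 = γ 1 1 + k * γ 1 0 := by
  rw [mul_entry, mul_entry, ModularGroup.coe_T_zpow]
  constructor <;> simp
  ring

/-- If the lower right entry is an odd prime, then the multiplier is a Jacobi symbol. -/
lemma Transforms.eq_jacobiSym (hQ : Q.PosDef) {γ : SL(2, ℤ)} {C : ℂ} (h : Transforms Q γ C)
    (hγ : γ ∈ CongruenceSubgroup.Gamma0 (level Q)) {p : ℕ} (hp : p.Prime) (hp2 : p ≠ 2)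
    (hd : γ 1 1 = p) : C = (jacobiSym ((-1) ^ r * (gram Q).det) p : ℂ) := by
  have : NeZero p := ⟨hp.ne_zero⟩
  have hpZ := Nat.prime_iff_prime_int.1 hp
  have hdet := det_eq_one γ
  rw [hd] at hdet
  have hb : ¬ (p : ℤ) ∣ γ 0 1 := fun hb => hpZ.not_isUnit <| isUnit_of_dvd_one <|
    hdet ▸ dvd_sub (Dvd.intro_left _ rfl) (hb.mul_right _)
  have hN : ¬ p ∣ level Q := fun hN => hpZ.not_isUnit <| isUnit_of_dvd_one <|
    hdet ▸ dvd_sub (Dvd.intro_left _ rfl)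
      (((Int.natCast_dvd_natCast.2 hN).trans (mem_Gamma0_iff_dvd.1 hγ)).mul_left _)
  rw [h.eq_expSum hQ hd, expSum_prime Q hp hp2 hb (not_dvd_det_of_not_dvd_level hQ hp hN)]
  have : (p : ℂ) ≠ 0 := by exact_mod_cast hp.ne_zero
  field_simp

/-- By Dirichlet's theorem, the lower right entry can be made prime. -/
lemma Transforms.exists_prime (hQ : Q.PosDef) {γ : SL(2, ℤ)} {C : ℂ} (h : Transforms Q γ C)
    (hγ : γ ∈ CongruenceSubgroup.Gamma0 (level Q)) :
    ∃ p : ℕ, p.Prime ∧ p ≠ 2 ∧ ((p : ℤ) : ZMod (level Q)) = (γ 1 1 : ℤ) ∧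
      C = (jacobiSym ((-1) ^ r * (gram Q).det) p : ℂ) := by
  have key : ∀ γ : SL(2, ℤ), Transforms Q γ C → γ ∈ CongruenceSubgroup.Gamma0 (level Q) →
      γ 1 0 ≠ 0 → ∃ p : ℕ, p.Prime ∧ p ≠ 2 ∧ ((p : ℤ) : ZMod (level Q)) = (γ 1 1 : ℤ) ∧
        C = (jacobiSym ((-1) ^ r * (gram Q).det) p : ℂ) := by
    intro γ h hγ hc
    have hcop : IsCoprime (γ 1 1) ((γ 1 0).natAbs : ℤ) := by
      rw [Int.natCast_natAbs]; exact (isCoprime_row γ).symm.abs_right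
    obtain ⟨p, hp2, hp, hmod⟩ := Nat.forall_exists_prime_gt_and_zmodEq 2
      (Int.natAbs_ne_zero.2 hc) hcop
    have hdvd : γ 1 0 ∣ p - γ 1 1 := by
      rw [← Int.natAbs_dvd]; exact hmod.symm.dvd
    obtain ⟨k, hk⟩ := hdvd
    have hrow := mul_T_zpow_row γ k
    have hmem := T_zpow_mem_Gamma0 (level Q) k
    have h1 := h.mul_right hQ hγ hmem (by rw [ModularGroup.coe_T_zpow]; simp)
    refine ⟨p, hp, hp2.ne', ?_, h1.eq_jacobiSym hQ (mul_mem hγ hmem) hp hp2.ne' ?_⟩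
    · rw [← sub_eq_zero, ← Int.cast_sub, hk, Int.cast_mul, CongruenceSubgroup.Gamma0_mem.1 hγ,
        zero_mul]
    · rw [hrow.2]; linarith
  by_cases hc : γ 1 0 = 0
  · -- multiply by the matrix `(1 0; N 1)` to make the lower left entry nonzero
    obtain ⟨U, hU0, hU1⟩ := (isCoprime_one_right (x := (level Q : ℤ))).exists_SL2_row 1
    have hU : U ∈ CongruenceSubgroup.Gamma0 (level Q) := by
      rw [mem_Gamma0_iff_dvd, hU0]
    have hd0 : γ 1 1 ≠ 0 := by
      intro h0; have := det_eq_one γ; rw [hc, h0] at this; simp at this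
    have hN : (level Q : ℤ) ≠ 0 := by exact_mod_cast (level_pos hQ).ne'
    have h1 := key _ (h.mul_right hQ hγ hU hU1) (mul_mem hγ hU) (by
      rw [mul_entry, hc, hU0, zero_mul, zero_add]; exact mul_ne_zero hd0 hN)
    have h2 : (γ * U) 1 1 = γ 1 1 := by rw [mul_entry, hc, hU1]; ring
    rwa [h2] at h1
  · exact key γ h hγ hc

/-- The Jacobi symbols at two primes that are congruent modulo the level agree: both are the
multiplier of matrices with lower left entry `N` that differ by a translation. -/
lemma jacobiSym_eq_of_prime (hQ : Q.PosDef) {p q : ℕ} (hp : p.Prime) (hq : q.Prime)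
    (hp2 : p ≠ 2) (hq2 : q ≠ 2) (hpN : ¬ p ∣ level Q)
    (hpq : ((p : ℤ) : ZMod (level Q)) = (q : ℤ)) :
    (jacobiSym ((-1) ^ r * (gram Q).det) p : ℂ) = jacobiSym ((-1) ^ r * (gram Q).det) q := by
  have hcop : IsCoprime (level Q : ℤ) (p : ℤ) :=
    (Nat.isCoprime_iff_coprime.2 ((Nat.Prime.coprime_iff_not_dvd hp).2 hpN)).symm
  obtain ⟨γ, h0, h1⟩ := hcop.exists_SL2_row 1
  have hγ : γ ∈ CongruenceSubgroup.Gamma0 (level Q) := by rw [mem_Gamma0_iff_dvd, h0]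
  obtain ⟨C, hC⟩ := exists_transforms hQ hγ
  obtain ⟨k, hk⟩ := (ZMod.intCast_eq_intCast_iff_dvd_sub _ _ _).1 hpq
  have hmem := T_zpow_mem_Gamma0 (level Q) k
  have hC' := hC.mul_right hQ hγ hmem (by rw [ModularGroup.coe_T_zpow]; simp)
  rw [← hC.eq_jacobiSym hQ hγ hp hp2 h1, ← hC'.eq_jacobiSym hQ (mul_mem hγ hmem) hq hq2]
  rw [(mul_T_zpow_row γ k).2, h0, h1]; linarith

/-- The multiplier only depends on the lower right entry modulo the level. -/
theorem Transforms.eq_of_eq (hQ : Q.PosDef) {γ γ' : SL(2, ℤ)} {C C' : ℂ} (h : Transforms Q γ C)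
    (h' : Transforms Q γ' C') (hγ : γ ∈ CongruenceSubgroup.Gamma0 (level Q))
    (hγ' : γ' ∈ CongruenceSubgroup.Gamma0 (level Q))
    (hd : ((γ 1 1 : ℤ) : ZMod (level Q)) = (γ' 1 1 : ℤ)) : C = C' := by
  obtain ⟨p, hp, hp2, hpd, rfl⟩ := h.exists_prime hQ hγ
  obtain ⟨q, hq, hq2, hqd, rfl⟩ := h'.exists_prime hQ hγ'
  refine jacobiSym_eq_of_prime hQ hp hq hp2 hq2 (fun hpN => ?_) (by rw [hpd, hd, hqd])
  have h1 : (p : ℤ) ∣ γ 1 1 - p := (Int.natCast_dvd_natCast.2 hpN).trans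
    ((ZMod.intCast_eq_intCast_iff_dvd_sub _ _ _).1 hpd)
  have h2 : (p : ℤ) ∣ γ 1 1 := by simpa using dvd_add h1 (dvd_refl (p : ℤ))
  have h3 : (p : ℤ) ∣ γ 1 0 := (Int.natCast_dvd_natCast.2 hpN).trans (mem_Gamma0_iff_dvd.1 hγ)
  exact (Nat.prime_iff_prime_int.1 hp).not_isUnit ((isCoprime_row γ).isUnit_of_dvd' h3 h2)

lemma exists_mem_Gamma0 (N : ℕ) {d : ℤ} (hd : IsCoprime (N : ℤ) d) :
    ∃ γ ∈ CongruenceSubgroup.Gamma0 N, γ 1 1 = d := by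
  obtain ⟨γ, h0, h1⟩ := hd.exists_SL2_row 1
  exact ⟨γ, by rw [mem_Gamma0_iff_dvd, h0], h1⟩

lemma mul_entry_eq {N : ℕ} {γ γ' : SL(2, ℤ)} (hγ : γ ∈ CongruenceSubgroup.Gamma0 N) :
    (((γ * γ') 1 1 : ℤ) : ZMod N) = (γ 1 1 : ℤ) * (γ' 1 1 : ℤ) := by
  rw [mul_entry, Int.cast_add, Int.cast_mul, CongruenceSubgroup.Gamma0_mem.1 hγ, zero_mul, zero_add,
    Int.cast_mul]

/-- The multiplier of the theta series is a Dirichlet character modulo the level, given by the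
Jacobi symbol. -/
theorem exists_character (hQ : Q.PosDef) : ∃ ε : DirichletCharacter ℂ (level Q),
    (∀ γ ∈ CongruenceSubgroup.Gamma0 (level Q), Transforms Q γ (ε ((γ 1 1 : ℤ) : ZMod (level Q)))) ∧
      IsCharacterOf Q ε := by
  set N := level Q with hN
  have : NeZero N := ⟨(level_pos hQ).ne'⟩
  choose! C hC using fun γ (h : γ ∈ CongruenceSubgroup.Gamma0 N) => exists_transforms hQ h
  have hrep : ∀ u : (ZMod N)ˣ, ∃ γ ∈ CongruenceSubgroup.Gamma0 N,
      ((γ 1 1 : ℤ) : ZMod N) = u := by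
    intro u
    obtain ⟨γ, hγ, h⟩ := exists_mem_Gamma0 N (d := ((u : ZMod N).val : ℤ))
      (Nat.isCoprime_iff_coprime.2 (ZMod.val_coe_unit_coprime u).symm)
    exact ⟨γ, hγ, by rw [h]; simp⟩
  choose R hR hRu using hrep
  have hwd : ∀ (u : (ZMod N)ˣ) (γ : SL(2, ℤ)), γ ∈ CongruenceSubgroup.Gamma0 N →
      ((γ 1 1 : ℤ) : ZMod N) = u → C γ = C (R u) := fun u γ hγ hu =>
    (hC γ hγ).eq_of_eq hQ (hC _ (hR u)) hγ (hR u) (by rw [hu, hRu])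
  set g : (ZMod N)ˣ →* ℂ :=
    { toFun := fun u => C (R u)
      map_one' := by
        rw [← hwd 1 1 (one_mem _) (by simp)]
        exact (hC 1 (one_mem _)).eq_one hQ (by simp)
      map_mul' := fun u u' => by
        rw [← hwd (u * u') (R u * R u') (mul_mem (hR u) (hR u'))
          (by rw [mul_entry_eq (hR u), hRu, hRu, Units.val_mul])]
        exact (hC _ (hR u)).mul_eq hQ (hC _ (hR u')) (hC _ (mul_mem (hR u) (hR u'))) } with hg
  set ε : DirichletCharacter ℂ N := MulChar.ofUnitHom g.toHomUnits with hε
  have hεu : ∀ u : (ZMod N)ˣ, ε u = C (R u) := fun u => by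
    rw [hε, MulChar.ofUnitHom_coe]; rfl
  have hεγ : ∀ γ ∈ CongruenceSubgroup.Gamma0 N, ε ((γ 1 1 : ℤ) : ZMod N) = C γ := by
    intro γ hγ
    have hu : IsUnit ((γ 1 1 : ℤ) : ZMod N) := by
      have h1 := congrArg (Int.cast : ℤ → ZMod N) (det_eq_one γ)
      rw [Int.cast_sub, Int.cast_mul, Int.cast_mul, CongruenceSubgroup.Gamma0_mem.1 hγ, mul_zero,
        sub_zero, Int.cast_one, mul_comm] at h1
      exact IsUnit.of_mul_eq_one _ h1
    obtain ⟨u, hu⟩ := hu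
    rw [← hu, hεu, hwd u γ hγ hu.symm]
  refine ⟨ε, fun γ hγ => by rw [hεγ γ hγ]; exact hC γ hγ, ?_⟩
  have hprime : ∀ p : ℕ, p.Prime → Odd p →
      ε ((p : ℕ) : ZMod N) = (jacobiSym ((-1) ^ r * (gram Q).det) p : ℂ) := by
    intro p hp hodd
    have hp2 : p ≠ 2 := by rintro rfl; exact absurd hodd (by decide)
    by_cases hpN : p ∣ N
    · have h1 : ¬ IsUnit ((p : ℕ) : ZMod N) := by
        rw [ZMod.isUnit_iff_coprime, Nat.Prime.coprime_iff_not_dvd hp]; exact not_not.2 hpN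
      rw [MulChar.map_nonunit ε h1]
      have : NeZero p := ⟨hp.ne_zero⟩
      have h2 : jacobiSym ((-1) ^ r * (gram Q).det) p = 0 := by
        rw [jacobiSym.eq_zero_iff_not_coprime]
        intro h3
        replace h3 := Int.isCoprime_iff_gcd_eq_one.2 h3
        exact (Nat.prime_iff_prime_int.1 hp).not_isUnit (h3.isUnit_of_dvd'
          ((dvd_det_of_dvd_level hQ hp hodd hpN).mul_left _) dvd_rfl)
      rw [h2]; simp
    · obtain ⟨γ, hγ, hd⟩ := exists_mem_Gamma0 N (d := (p : ℤ)) (Nat.isCoprime_iff_coprime.2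
        ((Nat.Prime.coprime_iff_not_dvd hp).2 hpN).symm)
      have h1 := hεγ γ hγ
      rw [hd, Int.cast_natCast] at h1
      rw [h1]
      exact (hC γ hγ).eq_jacobiSym hQ hγ hp hp2 hd
  intro n
  induction n using Nat.recOnMul with
  | zero => intro h; exact absurd h (by decide)
  | one => intro _; simp
  | prime p hp => exact hprime p hp
  | mul a b iha ihb =>
    intro h
    obtain ⟨ha, hb⟩ := Nat.odd_mul.1 h
    rw [Nat.cast_mul, map_mul, iha ha, ihb hb, jacobiSym.mul_right' _ ha.pos.ne' hb.pos.ne']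
    push_cast; rfl

/-- Every unit modulo the level is represented by an odd positive integer, so the values at odd
integers determine the character. -/
lemma IsCharacterOf.unique (hQ : Q.PosDef) {ε ε' : DirichletCharacter ℂ (level Q)}
    (h : IsCharacterOf Q ε) (h' : IsCharacterOf Q ε') : ε = ε' := by
  have : NeZero (level Q) := ⟨(level_pos hQ).ne'⟩
  refine MulChar.ext fun u => ?_
  have key : ∃ n : ℕ, Odd n ∧ ((n : ℕ) : ZMod (level Q)) = u := by
    rcases Nat.even_or_odd (u : ZMod (level Q)).val with he | ho
    · refine ⟨(u : ZMod (level Q)).val + level Q, ?_, by simp⟩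
      refine he.add_odd (Nat.not_even_iff_odd.1 fun hN => ?_)
      have h1 := ZMod.val_coe_unit_coprime u
      exact absurd (Nat.dvd_gcd he.two_dvd hN.two_dvd) (by rw [h1]; decide)
    · exact ⟨_, ho, by simp⟩
  obtain ⟨n, hn, hu⟩ := key
  rw [← hu, h n hn, h' n hn]

end QuadTheta

/-! ### The generating series as a Jacobi theta series -/

namespace QuadTheta
open Matrix

section generating

variable {f : ℕ} {Q : QuadraticForm ℤ (Fin f → ℤ)}

lemma pairing_eq (Q : QuadraticForm ℤ (Fin f → ℤ)) (v y : Fin f → ℂ) :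
    pairing Q v y = ∑ j, (v ᵥ* (gramR Q).map (algebraMap ℝ ℂ)) j * y j := by
  simp only [pairing, vecMul, dotProduct, gramR, Matrix.map_apply, Finset.sum_mul]
  rw [Finset.sum_comm]
  simp

lemma cbil_inv_vecMul (hQ : Q.PosDef) (v : Fin f → ℂ) :
    cbil (gramR Q)⁻¹ (v ᵥ* (gramR Q).map (algebraMap ℝ ℂ))
      (v ᵥ* (gramR Q).map (algebraMap ℝ ℂ)) = pairing Q v v := by
  conv_lhs =>
    arg 3
    rw [← posDef_transpose_eq (posDef_gramR hQ), transpose_map, vecMul_transpose]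
  rw [cbil_inv_mulVec hQ, pairing_eq]

lemma exists_norm_pairing_le (Q : QuadraticForm ℤ (Fin f → ℤ)) (v : Fin f → ℂ) :
    ∃ K : ℝ, ∀ m : Fin f → ℤ, ‖pairing Q v fun i => (m i : ℂ)‖ ≤ K * ‖fun i => (m i : ℝ)‖ := by
  refine ⟨∑ j, ‖(v ᵥ* (gramR Q).map (algebraMap ℝ ℂ)) j‖, fun m => ?_⟩
  rw [pairing_eq, Finset.sum_mul]
  refine (norm_sum_le _ _).trans (Finset.sum_le_sum fun j _ => ?_)
  rw [norm_mul]
  gcongr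
  rw [← Complex.ofReal_intCast, Complex.norm_real]
  exact norm_le_pi_norm (fun i => (m i : ℝ)) j

/-- The terms `e(Q(m) τ)` remain summable after multiplication by any exponential function of the
norm of `m`. -/
lemma summable_exp_mul_norm_jterm (hQ : Q.PosDef) {τ : ℂ} (hτ : 0 < τ.im) (K : ℝ) :
    Summable fun m : Fin f → ℤ => Real.exp (K * ‖fun i => (m i : ℝ)‖) * ‖jterm Q τ 0 m‖ := by
  obtain ⟨C, hC⟩ := exists_norm_gauss_le (posDef_gramR hQ) (re_neg_pi_I_mul hτ)
    ((2 * Real.pi * Complex.I) • (0 : Fin f → ℂ)) (K + 1)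
  refine Summable.of_nonneg_of_le (fun m => by positivity) (fun m => ?_)
    (summable_exp_neg_norm.mul_left C)
  rw [jterm_eq_gauss]
  refine (mul_le_mul_of_nonneg_left (hC _) (Real.exp_pos _).le).trans (le_of_eq ?_)
  rw [mul_left_comm, ← Real.exp_add]
  congr 2; ring

lemma thetaTerm_eq (Q : QuadraticForm ℤ (Fin f → ℤ)) (v : Fin f → ℂ) (k : ℕ)
    (τ : UpperHalfPlane) (m : Fin f → ℤ) :
    thetaTerm Q v k τ m = pairing Q v (fun i => (m i : ℂ)) ^ k * jterm Q τ 0 m := by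
  rw [thetaTerm, jterm]
  congr 2
  simp [mul_assoc]

lemma summable_thetaTerm (hQ : Q.PosDef) (v : Fin f → ℂ) (k : ℕ) (τ : UpperHalfPlane) :
    Summable (thetaTerm Q v k τ) := by
  obtain ⟨K, hK⟩ := exists_norm_pairing_le Q v
  refine Summable.of_norm_bounded
    ((summable_exp_mul_norm_jterm hQ τ.im_pos K).mul_left (k.factorial : ℝ)) fun m => ?_
  rw [thetaTerm_eq, norm_mul, norm_pow, ← mul_assoc]
  gcongr
  have h1 := Real.pow_div_factorial_le_exp _ (norm_nonneg (pairing Q v fun i => (m i : ℂ))) k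
  rw [div_le_iff₀ (by positivity), mul_comm] at h1
  refine h1.trans ?_
  gcongr
  exact hK m

/-- With `w² = 4 π i X`, the double family whose sum over the lattice gives the terms of the
generating series, and whose sum over `n` gives `cosh (w ⟨v, m⟩) e(Q(m) τ)`. -/
noncomputable def doubleTerm (Q : QuadraticForm ℤ (Fin f → ℤ)) (v : Fin f → ℂ) (τ w : ℂ)
    (m : Fin f → ℤ) (n : ℕ) : ℂ :=
  (w * pairing Q v fun i => (m i : ℂ)) ^ (2 * n) / (2 * n).factorial * jterm Q τ 0 m

lemma summable_doubleTerm (hQ : Q.PosDef) (v : Fin f → ℂ) {τ : ℂ} (hτ : 0 < τ.im) (w : ℂ) :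
    Summable fun p : (Fin f → ℤ) × ℕ => doubleTerm Q v τ w p.1 p.2 := by
  obtain ⟨K, hK⟩ := exists_norm_pairing_le Q v
  have hnorm : ∀ m n, ‖doubleTerm Q v τ w m n‖ =
      ‖w * pairing Q v fun i => (m i : ℂ)‖ ^ (2 * n) / (2 * n).factorial * ‖jterm Q τ 0 m‖ := by
    intro m n
    simp [doubleTerm]
  have hcosh : ∀ m, HasSum (fun n => ‖doubleTerm Q v τ w m n‖)
      (Real.cosh ‖w * pairing Q v fun i => (m i : ℂ)‖ * ‖jterm Q τ 0 m‖) := fun m => by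
    simp only [hnorm]
    exact (Real.hasSum_cosh _).mul_right _
  refine Summable.of_norm ((summable_prod_of_nonneg fun _ => norm_nonneg _).2
    ⟨fun m => (hcosh m).summable, ?_⟩)
  simp only [(hcosh _).tsum_eq]
  refine Summable.of_nonneg_of_le (fun m => mul_nonneg (Real.cosh_pos _).le (norm_nonneg _))
    (fun m => ?_) (summable_exp_mul_norm_jterm hQ hτ (‖w‖ * K))
  gcongr
  rw [Real.cosh_eq]
  have h0 := norm_nonneg (w * pairing Q v fun i => (m i : ℂ))
  have h1 : Real.exp (-‖w * pairing Q v fun i => (m i : ℂ)‖) ≤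
      Real.exp ‖w * pairing Q v fun i => (m i : ℂ)‖ := Real.exp_le_exp.2 (by linarith)
  have h2 : ‖w * pairing Q v fun i => (m i : ℂ)‖ ≤ ‖w‖ * K * ‖fun i => (m i : ℝ)‖ := by
    rw [norm_mul, mul_assoc]; gcongr; exact hK m
  have h3 := Real.exp_le_exp.2 h2
  linarith

lemma genTerm_eq (v : Fin f → ℂ) (τ : UpperHalfPlane) {X w : ℂ}
    (hw : w ^ 2 = 4 * Real.pi * Complex.I * X) (n : ℕ) :
    genTerm Q v τ X n = ∑' m, doubleTerm Q v τ w m n := by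
  have h1 : ∀ m, doubleTerm Q v τ w m n =
      w ^ (2 * n) / (2 * n).factorial * thetaTerm Q v (2 * n) τ m := fun m => by
    rw [doubleTerm, thetaTerm_eq]; ring
  simp only [h1, tsum_mul_left]
  rw [genTerm, theta, pow_mul w, hw]
  have h2 : (4 * Real.pi * Complex.I * X : ℂ) = 2 * (2 * Real.pi * Complex.I * X) := by ring
  rw [h2]
  generalize 2 * Real.pi * Complex.I * X = Y
  rw [mul_pow]
  ring

lemma exists_sq_eq (X : ℂ) : ∃ w : ℂ, w ^ 2 = 4 * Real.pi * Complex.I * X :=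
  IsAlgClosed.exists_pow_nat_eq _ two_pos

lemma summable_genTerm (hQ : Q.PosDef) (v : Fin f → ℂ) (τ : UpperHalfPlane) (X : ℂ) :
    Summable (genTerm Q v τ X) := by
  obtain ⟨w, hw⟩ := exists_sq_eq X
  have h := (summable_doubleTerm hQ v τ.im_pos w).prod_symm.prod
  exact h.congr fun n => (genTerm_eq v τ hw n).symm

/-- The generating series is a specialization of the Jacobi theta series. -/
theorem genTheta_eq_jtheta (hQ : Q.PosDef) (v : Fin f → ℂ) (τ : UpperHalfPlane) {X w : ℂ}
    (hw : w ^ 2 = 4 * Real.pi * Complex.I * X) :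
    genTheta Q v τ X = jtheta Q τ
      ((w / (2 * Real.pi * Complex.I)) • (v ᵥ* (gramR Q).map (algebraMap ℝ ℂ))) := by
  set u := (w / (2 * Real.pi * Complex.I)) • (v ᵥ* (gramR Q).map (algebraMap ℝ ℂ)) with hu
  have hpi : (Real.pi : ℂ) ≠ 0 := by exact_mod_cast Real.pi_ne_zero
  have hs := summable_doubleTerm hQ v τ.im_pos w
  have h1 : genTheta Q v τ X = ∑' m, ∑' n, doubleTerm Q v τ w m n := by
    rw [genTheta, tsum_congr fun n => genTerm_eq v τ hw n]
    exact hs.tsum_comm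
  have hum : ∀ m : Fin f → ℤ, 2 * Real.pi * Complex.I * ∑ i, u i * (m i : ℂ) =
      w * pairing Q v fun i => (m i : ℂ) := by
    intro m
    simp only [hu, pairing_eq, Pi.smul_apply, smul_eq_mul, Finset.mul_sum]
    refine Finset.sum_congr rfl fun i _ => ?_
    have := Complex.I_ne_zero
    field_simp
  have h2 : ∀ m, ∑' n, doubleTerm Q v τ w m n = (jterm Q τ u m + jterm Q τ (-u) m) / 2 := by
    intro m
    have h3 : HasSum (fun n => doubleTerm Q v τ w m n)
        (Complex.cosh (w * pairing Q v fun i => (m i : ℂ)) * jterm Q τ 0 m) :=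
      (Complex.hasSum_cosh _).mul_right _
    rw [h3.tsum_eq, Complex.cosh, ← hum, jterm, jterm, jterm, div_mul_eq_mul_div, add_mul,
      ← Complex.exp_add, ← Complex.exp_add]
    congr 3
    · simp; ring
    · simp; ring
  have h4 := (summable_norm_jterm hQ τ.im_pos u).of_norm
  have h5 := (summable_norm_jterm hQ τ.im_pos (-u)).of_norm
  simp only [h1, h2]
  rw [tsum_div_const, h4.tsum_add h5]
  change (jtheta Q τ u + jtheta Q τ (-u)) / 2 = _
  rw [jtheta_neg]; ring

end generating

end QuadTheta

theorem theorem1 (r : ℕ) (Q : QuadraticForm ℤ (Fin (2 * r) → ℤ)) (hQ : Q.PosDef) :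
    (∃! ε : DirichletCharacter ℂ (QuadTheta.level Q), QuadTheta.IsCharacterOf Q ε) ∧
    (∀ (v : Fin (2 * r) → ℂ) (k : ℕ) (τ : UpperHalfPlane),
      Summable (QuadTheta.thetaTerm Q v k τ)) ∧
    (∀ (v : Fin (2 * r) → ℂ) (τ : UpperHalfPlane) (X : ℂ),
      Summable (QuadTheta.genTerm Q v τ X)) ∧
    ∀ ε : DirichletCharacter ℂ (QuadTheta.level Q), QuadTheta.IsCharacterOf Q ε →
      ∀ (v : Fin (2 * r) → ℂ) (γ : SL(2, ℤ)), γ ∈ CongruenceSubgroup.Gamma0 (QuadTheta.level Q) →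
        ∀ (τ : UpperHalfPlane) (X : ℂ),
          QuadTheta.genTheta Q v (γ • τ) (X / ((γ 1 0 : ℂ) * (τ : ℂ) + (γ 1 1 : ℂ)) ^ 2) =
            ε ((γ 1 1 : ℤ) : ZMod (QuadTheta.level Q)) *
              ((γ 1 0 : ℂ) * (τ : ℂ) + (γ 1 1 : ℂ)) ^ r *
              Complex.exp ((γ 1 0 : ℂ) * QuadTheta.pairing Q v v * X /
                ((γ 1 0 : ℂ) * (τ : ℂ) + (γ 1 1 : ℂ))) *
              QuadTheta.genTheta Q v τ X := by
  obtain ⟨ε₀, htr, hε₀⟩ := QuadTheta.exists_character hQ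
  refine ⟨⟨ε₀, hε₀, fun ε hε => hε.unique hQ hε₀⟩, QuadTheta.summable_thetaTerm hQ,
    QuadTheta.summable_genTerm hQ, fun ε hε v γ hγ τ X => ?_⟩
  obtain rfl := hε.unique hQ hε₀
  obtain ⟨w, hw⟩ := QuadTheta.exists_sq_eq X
  have hT := QuadTheta.automorphy_ne_zero γ τ
  set T : ℂ := (γ 1 0 : ℂ) * (τ : ℂ) + (γ 1 1 : ℂ) with hTd
  have hpi : (Real.pi : ℂ) ≠ 0 := by exact_mod_cast Real.pi_ne_zero
  have hI := Complex.I_ne_zero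
  have hw' : (T⁻¹ * w) ^ 2 = 4 * Real.pi * Complex.I * (X / T ^ 2) := by
    rw [mul_pow, hw]; field_simp
  rw [QuadTheta.genTheta_eq_jtheta hQ v (γ • τ) hw', QuadTheta.genTheta_eq_jtheta hQ v τ hw,
    mul_div_assoc, mul_smul, htr γ hγ τ]
  congr 3
  rw [QuadTheta.cbil_smul_left, QuadTheta.cbil_smul_right, QuadTheta.cbil_inv_vecMul hQ, ← hTd]
  have h1 : Real.pi * Complex.I * (w / (2 * Real.pi * Complex.I) *
      (w / (2 * Real.pi * Complex.I))) = X := by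
    have h2 : w / (2 * Real.pi * Complex.I) * (w / (2 * Real.pi * Complex.I)) =
        w ^ 2 / (2 * Real.pi * Complex.I) ^ 2 := by ring
    rw [h2, hw]; field_simp; ring
  rw [← h1]
  ring
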